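/- Let $\Theta\subset\mathbb R$ be a set and, for each $t\in\Theta$, let $\xi_{1,t},\xi_{2,t},\dots$ be i.i.d. real-valued random variables with distribution $F_t$, finite fourth moment, and $$\mathbb E\,\xi_{i,t}=0,\qquad \mathbb E\,\xi_{i,t}^2=1,\qquad \mathbb E\,\xi_{i,t}^3=\rho_t,\qquad \mathbb E\,\xi_{i,t}^4-3=\kappa_t .$$ Let $\Phi$ and $\varphi$ be the distribution function and density of $\mathcal N(0,1)$, let $f_t$ be the characteristic function of $F_t$, and for $n\ge 1$, $s\in\mathbb R$, $t\in\Theta$ put $$F_n(s,t)=P\Big(\sum_{i=1}^n\xi_{i,t}<s\sqrt n\Big),\qquad H_n(s,t)=\Phi(s)-\frac{\varphi(s)}{\sqrt n}\,\frac{\rho_t}{6}(s^2-1),$$ $$G_n(s,t)=H_n(s,t)-\frac{\varphi(s)}{n}\Big[\frac{\kappa_t}{24}(s^3-3s)+\frac{\rho_t^2}{72}(s^5-10s^3+15s)\Big].$$ (a) Suppose that $\sup_{t\in\Theta}\kappa_t<\infty$ and that there is some $u_0>0$ such that for all $u_1$ $$\text{(C')}\qquad \sup_{u_0<u<u_1}\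 \sup_{t\in\Theta}|f_t(u)|<1 .$$ Then, as $n\to\infty$, $\displaystyle\sup_{s\in\mathbb R}\sup_{t\in\Theta}|F_n(s,t)-H_n(s,t)|=o(n^{-1/2})$. (b) Suppose that $\sup_{t\in\Theta}\mathbb E|\xi_{i,t}|^5<\infty$ and that $$\text{(C)}\qquad \limsup_{u\to\infty}\ \sup_{t\in\Theta}|f_t(u)|<1 .$$ Then, as $n\to\infty$, $\displaystyle\sup_{s\in\mathbb R}\sup_{t\in\Theta}|F_n(s,t)-G_n(s,t)|=O(n^{-3/2})$. In both cases the suprema are finite for every $n\ge 1$. -/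

import Mathlib

open MeasureTheory ProbabilityTheory Filter Asymptotics

/-- `F_n(s) = P(∑_{i=1}^n X_i < s √n)`; the sequence `X` is indexed from `0`, so the first `n`
members are `X 0, …, X (n - 1)`. -/
noncomputable def normalizedSumDist {Ω : Type*} [MeasurableSpace Ω] (P : Measure Ω)
    (X : ℕ → Ω → ℝ) (n : ℕ) (s : ℝ) : ℝ :=
  P.real {ω | ∑ i ∈ Finset.range n, X i ω < s * √(n : ℝ)}

/-- First-order Edgeworth expansion with skewness `ρ`. -/
noncomputable def edgeworthH (ρ : ℝ) (n : ℕ) (s : ℝ) : ℝ :=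
  cdf (gaussianReal 0 1) s - gaussianPDFReal 0 1 s / √(n : ℝ) * (ρ / 6 * (s ^ 2 - 1))

/-- Second-order Edgeworth expansion with skewness `ρ` and excess kurtosis `κ`. -/
noncomputable def edgeworthG (ρ κ : ℝ) (n : ℕ) (s : ℝ) : ℝ :=
  edgeworthH ρ n s - gaussianPDFReal 0 1 s / (n : ℝ) *
    (κ / 24 * (s ^ 3 - 3 * s) + ρ ^ 2 / 72 * (s ^ 5 - 10 * s ^ 3 + 15 * s))

/-- Condition (C'): for some `u₀ > 0` and all `u₁`, `sup_{u₀ < u < u₁} sup_t |f_t(u)| < 1`, where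
`f_t` is the characteristic function of `F t`. (All values lie in `[0, 1]`, so the real suprema
are the true ones.) -/
def UniformNoLattice {ι : Type*} (F : ι → Measure ℝ) : Prop :=
  ∃ u₀ : ℝ, 0 < u₀ ∧ ∀ u₁ : ℝ, (⨆ u : Set.Ioo u₀ u₁, ⨆ t : ι, ‖charFun (F t) (u : ℝ)‖) < 1

/-- Condition (C): `limsup_{u → ∞} sup_t |f_t(u)| < 1`. -/
def UniformCramer {ι : Type*} (F : ι → Measure ℝ) : Prop :=
  limsup (fun u : ℝ => ⨆ t : ι, ‖charFun (F t) u‖) atTop < 1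

/-!
The proof is Esseen's Fourier-analytic one, with all constants uniform in the parameter `t`.

**Smoothing.** The Fejér probability measure `κ` has a characteristic function supported in
`[-1, 1]`, so its distribution function is, up to an additive constant, a multiple of
`∫ v in 0..1, (1 - v) * (z * sinc (v * z))` (`exists_fejer_measure`). Averaging the difference `D`
of the distribution function of `μ` and the primitive of a density `g` against `κ`, rescaled by
`1 / T`, therefore only involves the Fourier transforms of `μ` and `g` on `(0, T]`. Since `D` decreases at
most at the rate `M = sup |g|`, the supremum of `|D|` is controlled by these averages and `M / T`
(`abs_le_of_abs_average_le`). The result is Esseen's inequality `exists_smoothing_const`. It is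
applied with the Edgeworth density, a combination of Hermite functions; their Fourier transforms and
primitives are explicit (`integral_cexp_mul_hermiteGaussian`,
`setIntegral_Iio_hermiteGaussian_succ`).

**Near the origin.** For `|v| ≤ 1 / (8 * K)`, where `K` bounds the moments, Taylor expansion shows
that `f v` is close to `exp (-v² / 2 + q)` with `q` the next one or two terms of the cumulant
expansion; both have modulus at most `exp (-v² / 4)`. The bound `‖aⁿ - bⁿ‖ ≤ n ‖a - b‖ rⁿ⁻¹` and an
expansion of `exp (n * q)` then give the comparison of `f (u / √n) ^ n` with the transform of the
Edgeworth density without any complex logarithm (`norm_pow_sub_exp_mul_sum_le`).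

**Away from the origin.** The inequality `1 - ‖f (2 * v)‖ ≤ 4 * (1 - ‖f v‖)` carries a bound
`‖f‖ ≤ c < 1` on large frequencies down to all frequencies at least `1 / (8 * K)`, so the two
conditions give `‖f (u / √n) ^ n‖ ≤ cⁿ` there (`UniformNoLattice.exists_norm_charFun_le`,
`UniformCramer.exists_norm_charFun_le`).

For part (a) one smooths at `T = A * √n` and lets `A` be large: the error is `O(1 / (A * √n))` plus
terms of order `1 / n` and `A * √n * cⁿ`. For part (b) one takes `T = n ^ (3 / 2)`.
-/

/-! ### The Fejér kernel -/

/-- The Fejér kernel is the cosine transform of the triangle function. -/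
lemma integral_triangle_mul_cos (y : ℝ) :
    ∫ v in (0 : ℝ)..1, (1 - v) * Real.cos (v * y) = Real.sinc (y / 2) ^ 2 / 2 := by
  rcases eq_or_ne y 0 with rfl | hy
  · simp only [mul_zero, Real.cos_zero, mul_one, zero_div, Real.sinc_zero]
    rw [intervalIntegral.integral_sub (by simp) (by simp)]
    simp
    norm_num
  · have hd : ∀ v ∈ Set.uIcc (0 : ℝ) 1, HasDerivAt
        (fun v => (1 - v) * Real.sin (v * y) / y - Real.cos (v * y) / y ^ 2)
        ((1 - v) * Real.cos (v * y)) v := by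
      intro v _
      have h1 : HasDerivAt (fun v : ℝ => v * y) y v := by
        simpa using (hasDerivAt_id v).mul_const y
      have h2 : HasDerivAt (fun v : ℝ => 1 - v) (-1) v := by
        simpa using (hasDerivAt_id v).const_sub 1
      convert! ((h2.mul h1.sin).div_const y).sub (h1.cos.div_const (y ^ 2)) using 1
      field_simp
      ring
    rw [intervalIntegral.integral_eq_sub_of_hasDerivAt hd
      (Continuous.intervalIntegrable (by fun_prop) _ _), Real.sinc_of_ne_zero (by simpa using hy)]
    have h3 : Real.sin (y / 2) ^ 2 = (1 - Real.cos y) / 2 := by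
      have := Real.cos_sq (y / 2)
      have h4 := Real.sin_sq_add_cos_sq (y / 2)
      rw [show 2 * (y / 2) = y by ring] at this
      linarith
    simp only [sub_self, zero_mul, zero_div, one_mul, Real.sin_zero, mul_zero, Real.cos_zero,
      div_pow, h3]
    field_simp
    ring

lemma integral_mul_cos (v z : ℝ) : ∫ y in (0 : ℝ)..z, Real.cos (v * y) = z * Real.sinc (v * z) := by
  rcases eq_or_ne v 0 with rfl | hv
  · simp
  rcases eq_or_ne z 0 with rfl | hz
  · simp
  rw [intervalIntegral.integral_comp_mul_left _ hv, integral_cos,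
    Real.sinc_of_ne_zero (mul_ne_zero hv hz)]
  simp only [mul_zero, Real.sin_zero, sub_zero, smul_eq_mul]
  field_simp

lemma integral_sinc_sq_eq (z : ℝ) :
    ∫ y in (0 : ℝ)..z, Real.sinc (y / 2) ^ 2 / 2 =
      ∫ v in (0 : ℝ)..1, (1 - v) * (z * Real.sinc (v * z)) := by
  simp_rw [← integral_triangle_mul_cos, ← integral_mul_cos, ← intervalIntegral.integral_const_mul]
  refine intervalIntegral_intervalIntegral_swap ?_
  have hc : Continuous (Function.uncurry fun y v : ℝ => (1 - v) * Real.cos (v * y)) := by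
    unfold Function.uncurry
    fun_prop
  exact (hc.continuousOn.integrableOn_compact (isCompact_uIcc.prod isCompact_uIcc)).mono_set
    (Set.prod_mono Set.uIoc_subset_uIcc Set.uIoc_subset_uIcc)

lemma integrable_sinc_sq : Integrable fun y : ℝ => Real.sinc (y / 2) ^ 2 / 2 := by
  have hc : Continuous fun y : ℝ => Real.sinc (y / 2) ^ 2 / 2 := by
    have := Real.continuous_sinc
    fun_prop
  refine (integrable_inv_one_add_sq.const_mul 4).mono' hc.aestronglyMeasurable (ae_of_all _ ?_)
  intro y
  rw [Real.norm_of_nonneg (by positivity)]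
  have h1 : Real.sinc (y / 2) ^ 2 ≤ 1 := by
    rw [sq_le_one_iff_abs_le_one]; exact Real.abs_sinc_le_one _
  have h2 : Real.sinc (y / 2) ^ 2 * y ^ 2 ≤ 4 := by
    rcases eq_or_ne y 0 with rfl | hy
    · simp
    rw [Real.sinc_of_ne_zero (by simpa using hy), div_pow]
    have := Real.sin_sq_le_one (y / 2)
    field_simp
    linarith
  rw [← div_eq_mul_inv, le_div_iff₀ (by positivity)]
  nlinarith

/-- The Fejér probability measure, described through its distribution function: a probability
measure whose characteristic function is supported in `[-1, 1]`. -/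
lemma exists_fejer_measure : ∃ κ : Measure ℝ, IsProbabilityMeasure κ ∧ ∃ C w : ℝ, 0 < C ∧
    ∀ z, κ.real (Set.Iio z) = w + C * ∫ v in (0 : ℝ)..1, (1 - v) * (z * Real.sinc (v * z)) := by
  set K : ℝ → ℝ := fun y => Real.sinc (y / 2) ^ 2 / 2 with hK
  have hc : Continuous K := by
    have := Real.continuous_sinc
    fun_prop
  have hi : Integrable K := integrable_sinc_sq
  have h0 : ∀ y, 0 ≤ K y := fun y => by positivity
  have hpos : 0 < ∫ y, K y := by
    refine integral_pos_of_integrable_nonneg_nonzero (x := 0) hc hi h0 ?_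
    simp [hK]
  set c := ∫ y, K y with hcdef
  have hi' : Integrable fun y => K y / c := hi.div_const c
  have hm : ∀ s, MeasurableSet s →
      (volume.withDensity fun y => ENNReal.ofReal (K y / c)).real s = ∫ y in s, K y / c := by
    intro s hs
    rw [measureReal_def, withDensity_apply _ hs, integral_eq_lintegral_of_nonneg_ae
      (ae_of_all _ fun y => div_nonneg (h0 y) hpos.le) hi'.aestronglyMeasurable.restrict]
  refine ⟨volume.withDensity fun y => ENNReal.ofReal (K y / c), ⟨?_⟩, 1 / c,
    (∫ y in Set.Iio 0, K y) / c, by positivity, fun z => ?_⟩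
  · rw [withDensity_apply _ MeasurableSet.univ, Measure.restrict_univ,
      ← ofReal_integral_eq_lintegral_ofReal hi' (ae_of_all _ fun y => div_nonneg (h0 y) hpos.le),
      integral_div, ← hcdef, div_self hpos.ne', ENNReal.ofReal_one]
  · rw [hm _ measurableSet_Iio, integral_div, ← integral_sinc_sq_eq]
    have := intervalIntegral.integral_Iic_sub_Iic (f := K) (μ := volume) (a := 0) (b := z)
      hi.integrableOn hi.integrableOn
    rw [integral_Iic_eq_integral_Iio, integral_Iic_eq_integral_Iio] at this
    rw [← this]
    ring

/-! ### Smoothing -/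

/-- If `D` cannot decrease faster than at rate `M`, then `|D|` is controlled by the averages of `D`
against a probability measure: averaging around a point shifted by `h` to the correct side loses at
most `2 * M * h`, plus half of any bound of `|D|` on the tail. -/
lemma abs_le_of_abs_average_le (κ : Measure ℝ) [IsProbabilityMeasure κ] {D : ℝ → ℝ}
    {η M S h T : ℝ} (hT : 0 < T) (hM0 : 0 ≤ M) (hh0 : 0 ≤ h)
    (hint : ∀ t, Integrable (fun y => D (t - y / T)) κ)
    (hη : ∀ s, |D s| ≤ η) (hM : ∀ s s', s ≤ s' → D s - M * (s' - s) ≤ D s')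
    (hS : ∀ t, |∫ y, D (t - y / T) ∂κ| ≤ S) (hh : κ.real {y | h * T < |y|} ≤ 1 / 4) (s : ℝ) :
    |D s| ≤ S + 2 * M * h + η / 2 := by
  have hη0 : 0 ≤ η := (abs_nonneg _).trans (hη 0)
  set A : Set ℝ := {y | h * T < |y|} with hA
  have hAm : MeasurableSet A := measurableSet_lt measurable_const measurable_abs
  have hAi : ∀ c : ℝ, Integrable (fun y => c + A.indicator (fun _ => 2 * η) y) κ := fun c =>
    (integrable_const _).add ((integrable_const _).indicator hAm)
  have hval : ∀ c : ℝ, ∫ y, (c + A.indicator (fun _ => 2 * η) y) ∂κ ≤ c + η / 2 := by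
    intro c
    rw [integral_add (integrable_const _) ((integrable_const _).indicator hAm),
      integral_indicator_const _ hAm]
    simp only [integral_const, probReal_univ, smul_eq_mul]
    nlinarith
  have hin : ∀ y, y ∉ A → |y / T| ≤ h := by
    intro y hy
    rw [hA, Set.mem_ofPred_eq, not_lt] at hy
    rw [abs_div, abs_of_pos hT, div_le_iff₀ hT]
    exact hy
  rw [abs_le]
  constructor
    -- average around `s - h`, where `D ≤ D s + 2 * M * h` off the tail
  · have key : ∀ y, D (s - h - y / T) ≤ D s + 2 * M * h + A.indicator (fun _ => 2 * η) y := by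
      intro y
      by_cases hy : y ∈ A
      · rw [Set.indicator_of_mem hy]
        have h1 := abs_le.1 (hη (s - h - y / T))
        have h2 := abs_le.1 (hη s)
        have := mul_nonneg hM0 hh0
        linarith
      · rw [Set.indicator_of_notMem hy]
        have h1 := abs_le.1 (hin y hy)
        have h2 := hM (s - h - y / T) s (by linarith)
        have h3 := mul_nonneg hM0 (sub_nonneg.2 h1.2)
        nlinarith
    have h1 := integral_mono (hint (s - h)) (hAi _) key
    have h2 := (abs_le.1 (hS (s - h))).1
    have h3 := hval (D s + 2 * M * h)
    linarith
  · have key : ∀ y, D s - D (s + h - y / T) ≤ 2 * M * h + A.indicator (fun _ => 2 * η) y := by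
      intro y
      by_cases hy : y ∈ A
      · rw [Set.indicator_of_mem hy]
        have h1 := abs_le.1 (hη (s + h - y / T))
        have h2 := abs_le.1 (hη s)
        have := mul_nonneg hM0 hh0
        linarith
      · rw [Set.indicator_of_notMem hy]
        have h1 := abs_le.1 (hin y hy)
        have h2 := hM s (s + h - y / T) (by linarith)
        have h3 := mul_nonneg hM0 (by linarith : 0 ≤ h + y / T)
        nlinarith
    have h1 : ∫ y, (D s - D (s + h - y / T)) ∂κ ≤ _ :=
      integral_mono ((integrable_const _).sub (hint (s + h))) (hAi _) key
    rw [integral_sub (integrable_const _) (hint (s + h))] at h1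
    simp only [integral_const, probReal_univ, one_smul] at h1
    have h2 := (abs_le.1 (hS (s + h))).2
    have h3 := hval (2 * M * h)
    linarith

section Fubini

variable {κ m : Measure ℝ} [IsProbabilityMeasure κ] [SFinite m] {w : ℝ → ℝ}

lemma integrable_prod_indicator (hw : Integrable w m) (t T : ℝ) :
    Integrable (Function.uncurry fun y x : ℝ => (Set.Iio (t - y / T)).indicator w x)
      (κ.prod m) := by
  have h1 : Integrable (fun p : ℝ × ℝ => w p.2) (κ.prod m) := hw.comp_snd κ
  have h2 : MeasurableSet {p : ℝ × ℝ | p.2 < t - p.1 / T} :=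
    measurableSet_lt measurable_snd (by fun_prop)
  exact h1.indicator h2

lemma integrable_setIntegral_Iio (hw : Integrable w m) (t T : ℝ) :
    Integrable (fun y => ∫ x in Set.Iio (t - y / T), w x ∂m) κ := by
  refine (integrable_prod_indicator (κ := κ) hw t T).integral_prod_left.congr (ae_of_all _ ?_)
  intro y
  exact integral_indicator (measurableSet_Iio (a := t - y / T))

/-- Averaging the distribution function of the signed measure `w • m` against `κ`, rescaled by
`1 / T`, integrates the distribution function of `κ` against `w • m`. -/
lemma integral_setIntegral_Iio (hw : Integrable w m) (t : ℝ) {T : ℝ} (hT : 0 < T) :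
    ∫ y, (∫ x in Set.Iio (t - y / T), w x ∂m) ∂κ =
      ∫ x, κ.real (Set.Iio (T * (t - x))) * w x ∂m := by
  simp_rw [← integral_indicator measurableSet_Iio]
  rw [integral_integral_swap (integrable_prod_indicator hw t T)]
  refine integral_congr_ae (ae_of_all _ fun x => ?_)
  have : (fun y => (Set.Iio (t - y / T)).indicator w x) =
      (Set.Iio (T * (t - x))).indicator fun _ => w x := by
    ext y
    have h : x < t - y / T ↔ y < T * (t - x) := by
      rw [lt_sub_comm, div_lt_iff₀' hT]
    by_cases hx : x < t - y / T
    · simp [Set.indicator, hx, h.1 hx]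
    · simp [Set.indicator, hx, mt h.2 hx]
  simp only [this]
  rw [integral_indicator_const _ measurableSet_Iio, smul_eq_mul]

/-- Fubini's theorem for the kernel of `exists_fejer_measure`; the first moment of `w • m` makes the
integrand absolutely integrable although `sin (v * z) / v` is unbounded in `z`. -/
lemma integral_mul_sinc_kernel (hw : Integrable w m) (hxw : Integrable (fun x => x * w x) m)
    (t T : ℝ) :
    Integrable (fun v => (1 - v) * ∫ x, T * (t - x) * Real.sinc (v * (T * (t - x))) * w x ∂m)
      (volume.restrict (Set.uIoc (0 : ℝ) 1)) ∧
    Integrable (fun x => (∫ v in (0 : ℝ)..1,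
      (1 - v) * (T * (t - x) * Real.sinc (v * (T * (t - x))))) * w x) m ∧
    ∫ x, (∫ v in (0 : ℝ)..1, (1 - v) * (T * (t - x) * Real.sinc (v * (T * (t - x))))) * w x ∂m =
      ∫ v in (0 : ℝ)..1,
        (1 - v) * ∫ x, T * (t - x) * Real.sinc (v * (T * (t - x))) * w x ∂m := by
  have h1 : Integrable (fun x => T * (t - x) * w x) m := by
    refine ((hw.const_mul (T * t)).sub (hxw.const_mul T)).congr (ae_of_all _ fun x => ?_)
    simp only [Pi.sub_apply]
    ring
  have hs := Real.continuous_sinc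
  have : IsFiniteMeasure (volume.restrict (Set.uIoc (0 : ℝ) 1)) := by
    rw [Set.uIoc_of_le zero_le_one]
    infer_instance
  have h2 : Integrable (Function.uncurry fun v x : ℝ =>
      (1 - v) * (T * (t - x) * Real.sinc (v * (T * (t - x))) * w x))
      ((volume.restrict (Set.uIoc (0 : ℝ) 1)).prod m) := by
    have h3 : Integrable (fun p : ℝ × ℝ => T * (t - p.2) * w p.2)
      ((volume.restrict (Set.uIoc (0 : ℝ) 1)).prod m) := h1.comp_snd _
    have h4 : Continuous fun p : ℝ × ℝ => Real.sinc (p.1 * (T * (t - p.2))) := by fun_prop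
    have h5 : Integrable (fun p : ℝ × ℝ => Real.sinc (p.1 * (T * (t - p.2))) *
        (T * (t - p.2) * w p.2)) ((volume.restrict (Set.uIoc (0 : ℝ) 1)).prod m) :=
      h3.bdd_mul h4.aestronglyMeasurable (c := 1) (ae_of_all _ fun p => Real.abs_sinc_le_one _)
    have h6 : Integrable (fun p : ℝ × ℝ => (1 - p.1) * (Real.sinc (p.1 * (T * (t - p.2))) *
        (T * (t - p.2) * w p.2))) ((volume.restrict (Set.uIoc (0 : ℝ) 1)).prod m) := by
      refine h5.bdd_mul (c := 1) (by fun_prop) ?_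
      have h7 : ∀ᵐ v ∂(volume.restrict (Set.uIoc (0 : ℝ) 1)), ‖1 - v‖ ≤ 1 := by
        refine ae_restrict_of_forall_mem measurableSet_uIoc fun v hv => ?_
        rw [Set.uIoc_of_le zero_le_one] at hv
        rw [Real.norm_eq_abs, abs_le]
        constructor <;> linarith [hv.1, hv.2]
      exact Measure.quasiMeasurePreserving_fst.ae h7
    refine h6.congr (ae_of_all _ fun p => ?_)
    simp only [Function.uncurry]
    ring
  have e1 : ∀ v, (1 - v) * ∫ x, T * (t - x) * Real.sinc (v * (T * (t - x))) * w x ∂m =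
      ∫ x, (1 - v) * (T * (t - x) * Real.sinc (v * (T * (t - x))) * w x) ∂m :=
    fun v => (integral_const_mul _ _).symm
  have e2 : ∀ x, (∫ v in (0 : ℝ)..1, (1 - v) * (T * (t - x) * Real.sinc (v * (T * (t - x))))) * w x
      = ∫ v in (0 : ℝ)..1, (1 - v) * (T * (t - x) * Real.sinc (v * (T * (t - x))) * w x) := by
    intro x
    rw [← intervalIntegral.integral_mul_const]
    refine intervalIntegral.integral_congr fun v _ => ?_
    ring
  simp_rw [e1, e2]
  refine ⟨h2.integral_prod_left, ?_, (intervalIntegral_integral_swap h2).symm⟩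
  have := h2.integral_prod_right
  rw [Set.uIoc_of_le zero_le_one] at this
  simp_rw [intervalIntegral.integral_of_le zero_le_one]
  exact this

end Fubini

/-- The sine transform of a signed measure `w • m`, expressed by its Fourier transform. -/
lemma mul_integral_sinc_eq_im {m : Measure ℝ} {w : ℝ → ℝ} (hw : Integrable w m)
    {v : ℝ} (hv : v ≠ 0) (t T : ℝ) :
    v * ∫ x, T * (t - x) * Real.sinc (v * (T * (t - x))) * w x ∂m =
      -(Complex.exp (-(v * T * t : ℝ) * Complex.I) *
        ∫ x, Complex.exp ((T * v : ℝ) * x * Complex.I) * w x ∂m).im := by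
  have hi : Integrable (fun x : ℝ => Complex.exp (-(v * T * t : ℝ) * Complex.I) *
      (Complex.exp ((T * v : ℝ) * x * Complex.I) * w x)) m := by
    refine Integrable.const_mul ?_ _
    refine hw.ofReal.bdd_mul (c := 1) (by fun_prop) (ae_of_all _ fun x => ?_)
    rw [← Complex.ofReal_mul, Complex.norm_exp_ofReal_mul_I]
  rw [← integral_const_mul, ← integral_const_mul]
  have h1 := integral_im hi
  simp only [RCLike.im_to_complex] at h1
  rw [← h1, ← integral_neg]
  refine integral_congr_ae (ae_of_all _ fun x => ?_)
  simp only
  have h2 : Complex.exp (-(v * T * t : ℝ) * Complex.I) *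
      (Complex.exp ((T * v : ℝ) * x * Complex.I) * w x) =
      Complex.exp ((-(v * (T * (t - x))) : ℝ) * Complex.I) * w x := by
    rw [← mul_assoc, ← Complex.exp_add]
    congr 2
    push_cast
    ring
  rw [h2, Complex.im_mul_ofReal, Complex.exp_ofReal_mul_I_im, Real.sin_neg]
  rcases eq_or_ne (T * (t - x)) 0 with h0 | h0
  · simp [h0]
  rw [Real.sinc_of_ne_zero (mul_ne_zero hv h0)]
  rw [show v * (T * (t - x) * (Real.sin (v * (T * (t - x))) / (v * (T * (t - x)))) * w x) =
    (v * (T * (t - x))) / (v * (T * (t - x))) * (Real.sin (v * (T * (t - x))) * w x) by ring,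
    div_self (mul_ne_zero hv h0)]
  ring

lemma exists_tail_le (κ : Measure ℝ) [IsProbabilityMeasure κ] :
    ∃ a : ℝ, 0 < a ∧ κ.real {y | a < |y|} ≤ 1 / 4 := by
  have h1 : Tendsto (fun n : ℕ => κ {y : ℝ | (n : ℝ) < |y|}) atTop
      (nhds (κ (⋂ n : ℕ, {y : ℝ | (n : ℝ) < |y|}))) := by
    refine tendsto_measure_iInter_atTop
      (fun n => (measurableSet_lt measurable_const measurable_abs).nullMeasurableSet) ?_
      ⟨0, measure_ne_top _ _⟩
    intro i j hij y hy
    have hy' : (j : ℝ) < |y| := hy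
    exact (Nat.cast_le.2 hij).trans_lt hy'
  have h2 : (⋂ n : ℕ, {y : ℝ | (n : ℝ) < |y|}) = ∅ := by
    refine Set.eq_empty_of_forall_notMem fun y hy => ?_
    obtain ⟨n, hn⟩ := exists_nat_gt |y|
    exact lt_asymm hn (Set.mem_iInter.1 hy n)
  rw [h2, measure_empty] at h1
  have h3 : Tendsto (fun n : ℕ => κ.real {y : ℝ | (n : ℝ) < |y|}) atTop (nhds 0) :=
    (ENNReal.tendsto_toReal ENNReal.zero_ne_top).comp h1
  obtain ⟨n, hn, hn0⟩ := ((h3.eventually_le_const (by norm_num : (0 : ℝ) < 1 / 4)).and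
    (eventually_gt_atTop 0)).exists
  exact ⟨n, by exact_mod_cast hn0, hn⟩

/-- **Esseen's smoothing inequality**, for a probability measure `μ` and a signed density `g` of
total mass `1` bounded by `M`. -/
theorem exists_smoothing_const : ∃ C : ℝ, 0 < C ∧ ∀ (μ : Measure ℝ) [IsProbabilityMeasure μ]
    (_ : Integrable (fun x : ℝ => x) μ) (g : ℝ → ℝ) (M : ℝ) (_ : Integrable g)
    (_ : Integrable fun x => x * g x) (_ : ∫ x, g x = 1) (_ : ∀ x, |g x| ≤ M)
    (T : ℝ) (_ : 0 < T) (b : ℝ → ℝ) (_ : IntervalIntegrable b volume 0 T)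
    (_ : ∀ u, 0 < u → u ≤ T →
      ‖charFun μ u - ∫ x : ℝ, Complex.exp (u * x * Complex.I) * g x‖ ≤ u * b u) (s : ℝ),
    |μ.real (Set.Iio s) - ∫ x in Set.Iio s, g x| ≤ C * ((∫ u in (0 : ℝ)..T, b u) + M / T) := by
  obtain ⟨κ, hκ, C, w₀, hC, hW⟩ := exists_fejer_measure
  obtain ⟨a, ha, hκa⟩ := exists_tail_le κ
  refine ⟨2 * C + 4 * a, by positivity, ?_⟩
  intro μ _ hμ g M hg hxg hg1 hgM T hT b hb hub s
  have hM0 : 0 ≤ M := (abs_nonneg _).trans (hgM 0)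
  set G : ℝ → ℝ := fun s => ∫ x in Set.Iio s, g x with hG
  set F : ℝ → ℝ := fun s => ∫ x in Set.Iio s, (1 : ℝ) ∂μ with hF
  have hFμ : ∀ s, F s = μ.real (Set.Iio s) := fun s => by simp [hF]
  set D : ℝ → ℝ := fun s => F s - G s with hD
  have h1i : Integrable (fun _ : ℝ => (1 : ℝ)) μ := integrable_const _
  have hx1 : Integrable (fun x : ℝ => x * (1 : ℝ)) μ := by simpa using hμ
  have hDint : ∀ t, Integrable (fun y => D (t - y / T)) κ := fun t =>
    (integrable_setIntegral_Iio h1i t T).sub (integrable_setIntegral_Iio hg t T)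
  have hbdd : BddAbove (Set.range fun s => |D s|) := by
    refine ⟨1 + ∫ x, |g x|, ?_⟩
    rintro _ ⟨s, rfl⟩
    have h1 : |F s| ≤ 1 := by
      rw [hFμ, abs_of_nonneg measureReal_nonneg]
      exact measureReal_le_one
    have h2 : |G s| ≤ ∫ x, |g x| :=
      (abs_integral_le_integral_abs).trans
        (setIntegral_le_integral hg.abs (ae_of_all _ fun x => abs_nonneg _))
    exact (abs_sub _ _).trans (add_le_add h1 h2)
  set η := ⨆ s, |D s| with hη
  have hηs : ∀ s, |D s| ≤ η := fun s => le_ciSup hbdd s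
  have hLip : ∀ s s', s ≤ s' → D s - M * (s' - s) ≤ D s' := by
    intro s s' hss
    have h1 : F s ≤ F s' := by
      rw [hFμ, hFμ]
      exact measureReal_mono (Set.Iio_subset_Iio hss)
    have h2 : G s' - G s = ∫ x in s..s', g x :=
      intervalIntegral.integral_Iio_sub_Iio' hg.integrableOn hg.integrableOn
    have h3 : |∫ x in s..s', g x| ≤ M * |s' - s| := by
      rw [← Real.norm_eq_abs]
      exact intervalIntegral.norm_integral_le_of_norm_le_const fun x _ => hgM x
    rw [abs_of_nonneg (sub_nonneg.2 hss)] at h3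
    have h4 := (abs_le.1 h3).2
    simp only [hD]
    linarith
  have hb0 : ∀ u, 0 < u → u ≤ T → 0 ≤ b u := fun u h0 h1 =>
    nonneg_of_mul_nonneg_right ((norm_nonneg _).trans (hub u h0 h1)) h0
  set S := C * ∫ u in (0 : ℝ)..T, b u with hSdef
  have hb00 : 0 ≤ ∫ u in (0 : ℝ)..T, b u := by
    rw [intervalIntegral.integral_of_le hT.le]
    exact setIntegral_nonneg measurableSet_Ioc fun u hu => hb0 u hu.1 hu.2
  have hS : ∀ t, |∫ y, D (t - y / T) ∂κ| ≤ S := by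
    intro t
    have e1 : ∫ y, D (t - y / T) ∂κ =
        (∫ x, κ.real (Set.Iio (T * (t - x))) * (1 : ℝ) ∂μ) -
          ∫ x, κ.real (Set.Iio (T * (t - x))) * g x := by
      rw [← integral_setIntegral_Iio h1i t hT, ← integral_setIntegral_Iio hg t hT]
      exact integral_sub (integrable_setIntegral_Iio h1i t T) (integrable_setIntegral_Iio hg t T)
    -- the constant `w₀` cancels in the difference, as both measures have total mass `1`
    have e2 : ∀ (m : Measure ℝ) [SFinite m] (w : ℝ → ℝ), Integrable w m →
        Integrable (fun x => x * w x) m → ∫ x, w x ∂m = 1 →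
        ∫ x, κ.real (Set.Iio (T * (t - x))) * w x ∂m = w₀ + C * ∫ v in (0 : ℝ)..1,
          (1 - v) * ∫ x, T * (t - x) * Real.sinc (v * (T * (t - x))) * w x ∂m := by
      intro m _ w hw hxw hw1
      obtain ⟨-, h2, h3⟩ := integral_mul_sinc_kernel hw hxw t T
      rw [← h3, ← integral_const_mul]
      have : w₀ = ∫ x, w₀ * w x ∂m := by rw [integral_const_mul, hw1, mul_one]
      nth_rewrite 1 [this]
      rw [← integral_add (hw.const_mul w₀) (h2.const_mul C)]
      refine integral_congr_ae (ae_of_all _ fun x => ?_)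
      simp only [hW]
      ring
    have i1 := (integral_mul_sinc_kernel h1i hx1 t T).1
    have i2 := (integral_mul_sinc_kernel hg hxg t T).1
    rw [e1, e2 μ _ h1i hx1 (by simp), e2 volume g hg hxg hg1, add_sub_add_left_eq_sub, ← mul_sub,
      abs_mul, abs_of_pos hC]
    refine mul_le_mul_of_nonneg_left ?_ hC.le
    rw [← intervalIntegral.integral_sub (intervalIntegrable_iff.2 i1) (intervalIntegrable_iff.2 i2)]
    have e3 : ∫ u in (0 : ℝ)..T, b u = ∫ v in (0 : ℝ)..1, T * b (T * v) := by
      rw [intervalIntegral.integral_const_mul, intervalIntegral.mul_integral_comp_mul_left]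
      simp
    rw [e3, ← Real.norm_eq_abs]
    refine intervalIntegral.norm_integral_le_of_norm_le zero_le_one (ae_of_all _ ?_) ?_
    · intro v hv
      have hTv : T * v ≤ T := mul_le_of_le_one_right hT.le hv.2
      have k1 := mul_integral_sinc_eq_im h1i hv.1.ne' t T
      have k2 := mul_integral_sinc_eq_im hg hv.1.ne' t T
      have k3 := hub (T * v) (mul_pos hT hv.1) hTv
      rw [charFun_apply_real] at k3
      set A1 := ∫ x, T * (t - x) * Real.sinc (v * (T * (t - x))) * (1 : ℝ) ∂μ
      set A2 := ∫ x, T * (t - x) * Real.sinc (v * (T * (t - x))) * g x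
      have k4 : v * |A1 - A2| ≤ T * v * b (T * v) := by
        refine le_trans ?_ k3
        rw [← abs_of_pos hv.1, ← abs_mul, mul_sub, abs_of_pos hv.1, k1, k2, neg_sub_neg,
          ← Complex.sub_im, ← mul_sub]
        refine (Complex.abs_im_le_norm _).trans ?_
        rw [norm_mul, ← Complex.ofReal_neg, Complex.norm_exp_ofReal_mul_I, one_mul, norm_sub_rev]
        simp
      have k5 : |A1 - A2| ≤ T * b (T * v) := by
        refine le_of_mul_le_mul_left ?_ hv.1
        linarith
      rw [← mul_sub, Real.norm_eq_abs, abs_mul, abs_of_nonneg (sub_nonneg.2 hv.2)]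
      refine le_trans ?_ k5
      exact mul_le_of_le_one_left (abs_nonneg _) (by linarith [hv.1])
    · have h := (hb.comp_mul_left (c := T)).const_mul T
      simpa [hT.ne'] using h
  have hfin : η ≤ S + 2 * M * (a / T) + η / 2 := by
    refine ciSup_le fun s =>
      abs_le_of_abs_average_le κ hT hM0 (by positivity) hDint hηs hLip hS ?_ s
    rwa [div_mul_cancel₀ _ hT.ne']
  have h5 : |μ.real (Set.Iio s) - ∫ x in Set.Iio s, g x| ≤ η := by
    rw [← hFμ]
    exact hηs s
  refine h5.trans ?_
  have h6 : 0 ≤ M / T := by positivity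
  have h7 : η ≤ 2 * S + 4 * a * (M / T) := by
    have : 2 * M * (a / T) = 2 * a * (M / T) := by ring
    linarith
  have h8 := mul_nonneg hC.le h6
  have h9 := mul_nonneg ha.le hb00
  rw [hSdef] at h7
  nlinarith

/-! ### Hermite functions -/

/-- The product of the `k`-th (probabilists') Hermite polynomial and the standard normal density,
which is `(-1) ^ k` times the `k`-th derivative of that density. -/
noncomputable def hermiteGaussian (k : ℕ) (x : ℝ) : ℝ :=
  Polynomial.aeval x (Polynomial.hermite k) * gaussianPDFReal 0 1 x

lemma gaussianPDFReal_zero_one (x : ℝ) :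
    gaussianPDFReal 0 1 x = (√(2 * Real.pi))⁻¹ * Real.exp (-(1 / 2) * x ^ 2) := by
  simp only [gaussianPDFReal_def, NNReal.coe_one, mul_one, sub_zero]
  congr 2
  ring

lemma hasDerivAt_gaussianPDFReal (x : ℝ) :
    HasDerivAt (gaussianPDFReal 0 1) (-x * gaussianPDFReal 0 1 x) x := by
  have h1 : HasDerivAt (fun x : ℝ => -(1 / 2) * x ^ 2) (-x) x := by
    convert! (hasDerivAt_pow 2 x).const_mul (-(1 / 2) : ℝ) using 1
    norm_num
    ring
  have h2 := (h1.exp).const_mul (√(2 * Real.pi))⁻¹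
  rw [← funext gaussianPDFReal_zero_one] at h2
  convert! h2 using 1
  rw [gaussianPDFReal_zero_one]
  ring

lemma hasDerivAt_hermiteGaussian (k : ℕ) (x : ℝ) :
    HasDerivAt (hermiteGaussian k) (-hermiteGaussian (k + 1) x) x := by
  have h1 := (Polynomial.hermite k).hasDerivAt_aeval x
  convert! h1.mul (hasDerivAt_gaussianPDFReal x) using 1
  rw [hermiteGaussian, Polynomial.hermite_succ]
  simp only [map_sub, map_mul, Polynomial.aeval_X]
  ring

lemma integrable_pow_mul_gaussianPDFReal (n : ℕ) :
    Integrable fun x => x ^ n * gaussianPDFReal 0 1 x := by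
  have h := integrable_rpow_mul_exp_neg_mul_sq (b := 1 / 2) (by norm_num) (s := n)
    (by have : (0 : ℝ) ≤ n := n.cast_nonneg
        linarith)
  simp_rw [Real.rpow_natCast] at h
  refine (h.const_mul (√(2 * Real.pi))⁻¹).congr (ae_of_all _ fun x => ?_)
  simp only [gaussianPDFReal_zero_one]
  ring

lemma integrable_aeval_mul_gaussianPDFReal (p : Polynomial ℤ) :
    Integrable fun x : ℝ => Polynomial.aeval x p * gaussianPDFReal 0 1 x := by
  simp_rw [Polynomial.aeval_eq_sum_range, Finset.sum_mul]
  refine integrable_finsetSum _ fun i _ => ?_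
  simp_rw [zsmul_eq_mul, mul_assoc]
  exact (integrable_pow_mul_gaussianPDFReal i).const_mul _

lemma integrable_hermiteGaussian (k : ℕ) : Integrable (hermiteGaussian k) :=
  integrable_aeval_mul_gaussianPDFReal _

lemma integrable_mul_hermiteGaussian (k : ℕ) : Integrable fun x => x * hermiteGaussian k x := by
  refine (integrable_aeval_mul_gaussianPDFReal (Polynomial.X * Polynomial.hermite k)).congr
    (ae_of_all _ fun x => ?_)
  simp only [hermiteGaussian, map_mul, Polynomial.aeval_X]
  ring

lemma abs_pow_mul_gaussianPDFReal_le (n : ℕ) (x : ℝ) :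
    |x ^ n * gaussianPDFReal 0 1 x| ≤ n.factorial * Real.exp 1 := by
  have h1 := Real.pow_div_factorial_le_exp |x| (abs_nonneg x) n
  rw [div_le_iff₀ (by positivity)] at h1
  have h2 : gaussianPDFReal 0 1 x ≤ Real.exp (-(1 / 2) * x ^ 2) := by
    rw [gaussianPDFReal_zero_one]
    refine mul_le_of_le_one_left (Real.exp_pos _).le (inv_le_one_of_one_le₀ ?_)
    rw [Real.one_le_sqrt]
    linarith [Real.pi_gt_three]
  rw [abs_mul, abs_pow, abs_of_nonneg (gaussianPDFReal_nonneg _ _ _)]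
  calc |x| ^ n * gaussianPDFReal 0 1 x
      ≤ (Real.exp |x| * n.factorial) * Real.exp (-(1 / 2) * x ^ 2) := by
        gcongr
        exact gaussianPDFReal_nonneg _ _ _
    _ = n.factorial * Real.exp (|x| + -(1 / 2) * x ^ 2) := by rw [Real.exp_add]; ring
    _ ≤ n.factorial * Real.exp 1 := by
      gcongr
      nlinarith [sq_nonneg (|x| - 1), sq_abs x]

lemma exists_abs_hermiteGaussian_le (k : ℕ) : ∃ C : ℝ, 0 < C ∧ ∀ x, |hermiteGaussian k x| ≤ C := by
  set p := Polynomial.hermite k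
  refine ⟨∑ i ∈ Finset.range (p.natDegree + 1), |(p.coeff i : ℝ)| * (i.factorial * Real.exp 1) + 1,
    by positivity, fun x => ?_⟩
  rw [hermiteGaussian, Polynomial.aeval_eq_sum_range, Finset.sum_mul]
  refine ((Finset.abs_sum_le_sum_abs _ _).trans (Finset.sum_le_sum fun i _ => ?_)).trans
    (le_add_of_nonneg_right zero_le_one)
  rw [zsmul_eq_mul, mul_assoc, abs_mul]
  exact mul_le_mul_of_nonneg_left (abs_pow_mul_gaussianPDFReal_le i x) (abs_nonneg _)

lemma setIntegral_Iio_hermiteGaussian_succ (k : ℕ) (s : ℝ) :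
    ∫ x in Set.Iio s, hermiteGaussian (k + 1) x = -hermiteGaussian k s := by
  have hd : ∀ x ∈ Set.Iic s, HasDerivAt (hermiteGaussian k) (-hermiteGaussian (k + 1) x) x :=
    fun x _ => hasDerivAt_hermiteGaussian k x
  have hi := (integrable_hermiteGaussian (k + 1)).neg.integrableOn (s := Set.Iic s)
  have h0 := tendsto_zero_of_hasDerivAt_of_integrableOn_Iic hd hi
    (integrable_hermiteGaussian k).integrableOn
  have h1 := integral_Iic_of_hasDerivAt_of_tendsto' hd hi h0
  rw [integral_neg, integral_Iic_eq_integral_Iio] at h1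
  linarith

lemma hermiteGaussian_zero (x : ℝ) : hermiteGaussian 0 x = gaussianPDFReal 0 1 x := by
  simp [hermiteGaussian]

lemma setIntegral_Iio_hermiteGaussian_zero (s : ℝ) :
    ∫ x in Set.Iio s, hermiteGaussian 0 x = cdf (gaussianReal 0 1) s := by
  simp_rw [hermiteGaussian_zero]
  rw [cdf_eq_real, measureReal_def, gaussianReal_apply_eq_integral _ one_ne_zero,
    ENNReal.toReal_ofReal (integral_nonneg fun x => gaussianPDFReal_nonneg _ _ _),
    integral_Iic_eq_integral_Iio]

lemma hermiteGaussian_two (x : ℝ) : hermiteGaussian 2 x = (x ^ 2 - 1) * gaussianPDFReal 0 1 x := by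
  simp only [hermiteGaussian]
  congr 1
  simp [Polynomial.hermite_succ]
  ring

lemma hermiteGaussian_three (x : ℝ) :
    hermiteGaussian 3 x = (x ^ 3 - 3 * x) * gaussianPDFReal 0 1 x := by
  simp only [hermiteGaussian]
  congr 1
  simp [Polynomial.hermite_succ]
  ring

lemma hermiteGaussian_five (x : ℝ) :
    hermiteGaussian 5 x = (x ^ 5 - 10 * x ^ 3 + 15 * x) * gaussianPDFReal 0 1 x := by
  simp only [hermiteGaussian]
  congr 1
  simp [Polynomial.hermite_succ]
  ring

lemma integrable_cexp_mul_hermiteGaussian (k : ℕ) (u : ℝ) :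
    Integrable fun x : ℝ => Complex.exp (u * x * Complex.I) * (hermiteGaussian k x : ℂ) := by
  refine (integrable_hermiteGaussian k).ofReal.bdd_mul (c := 1) (by fun_prop)
    (ae_of_all _ fun x => ?_)
  rw [← Complex.ofReal_mul, Complex.norm_exp_ofReal_mul_I]

lemma integral_cexp_mul_hermiteGaussian (k : ℕ) (u : ℝ) :
    ∫ x : ℝ, Complex.exp (u * x * Complex.I) * (hermiteGaussian k x : ℂ) =
      (u * Complex.I) ^ k * Complex.exp (-(u ^ 2 / 2)) := by
  induction k with
  | zero =>
    have h := charFun_gaussianReal (μ := 0) (v := 1) u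
    rw [charFun_apply_real, integral_gaussianReal_eq_integral_smul one_ne_zero] at h
    simp only [pow_zero, one_mul, hermiteGaussian_zero]
    convert! h using 1
    · refine integral_congr_ae (ae_of_all _ fun x => ?_)
      simp [mul_comm]
    · congr 1
      simp
  | succ k ih =>
    have h1 : ∀ x : ℝ, HasDerivAt (fun x : ℝ => Complex.exp (u * x * Complex.I))
        (Complex.exp (u * x * Complex.I) * (u * Complex.I)) x := by
      intro x
      have : HasDerivAt (fun x : ℝ => (u : ℂ) * x * Complex.I) (u * Complex.I) x := by
        have := ((Complex.ofRealCLM.hasDerivAt (x := x)).const_mul (u : ℂ)).mul_const Complex.I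
        simpa using this
      exact this.cexp
    have h2 : ∀ x : ℝ, HasDerivAt (fun x : ℝ => (hermiteGaussian k x : ℂ))
        (-(hermiteGaussian (k + 1) x : ℂ)) x := by
      intro x
      have := (hasDerivAt_hermiteGaussian k x).ofReal_comp
      simpa using this
    have h3 := integral_mul_deriv_eq_deriv_mul_of_integrable (fun x _ => h1 x) (fun x _ => h2 x)
      (by
        refine (integrable_cexp_mul_hermiteGaussian (k + 1) u).neg.congr (ae_of_all _ fun x => ?_)
        simp)
      (by
        refine ((integrable_cexp_mul_hermiteGaussian k u).const_mul (u * Complex.I)).congr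
          (ae_of_all _ fun x => ?_)
        simp only [Pi.mul_apply]
        ring)
      (integrable_cexp_mul_hermiteGaussian k u)
    simp only [mul_neg, integral_neg, neg_inj] at h3
    rw [h3, pow_succ', mul_assoc, ← ih, ← integral_const_mul]
    refine integral_congr_ae (ae_of_all _ fun x => ?_)
    simp only
    ring

/-- The density of the Edgeworth signed measure with coefficients `a`, `b`, `c` of the third, fourth
and sixth Hermite functions. -/
noncomputable def edgeworthDensity (a b c x : ℝ) : ℝ :=
  hermiteGaussian 0 x + a * hermiteGaussian 3 x + b * hermiteGaussian 4 x + c * hermiteGaussian 6 x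

section EdgeworthDensity

variable (a b c : ℝ)

lemma integrable_edgeworthDensity : Integrable (edgeworthDensity a b c) :=
  (((integrable_hermiteGaussian 0).add ((integrable_hermiteGaussian 3).const_mul a)).add
    ((integrable_hermiteGaussian 4).const_mul b)).add ((integrable_hermiteGaussian 6).const_mul c)

lemma integrable_mul_edgeworthDensity : Integrable fun x => x * edgeworthDensity a b c x := by
  refine ((((integrable_mul_hermiteGaussian 0).add
    ((integrable_mul_hermiteGaussian 3).const_mul a)).add
    ((integrable_mul_hermiteGaussian 4).const_mul b)).add
    ((integrable_mul_hermiteGaussian 6).const_mul c)).congr (ae_of_all _ fun x => ?_)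
  simp only [edgeworthDensity, Pi.add_apply]
  ring

lemma integral_cexp_mul_edgeworthDensity (u : ℝ) :
    ∫ x : ℝ, Complex.exp (u * x * Complex.I) * (edgeworthDensity a b c x : ℂ) =
      Complex.exp (-(u ^ 2 / 2)) * (1 + a * (u * Complex.I) ^ 3 + b * (u * Complex.I) ^ 4 +
        c * (u * Complex.I) ^ 6) := by
  have i := fun k => integrable_cexp_mul_hermiteGaussian k u
  have e : ∀ x : ℝ, Complex.exp (u * x * Complex.I) * (edgeworthDensity a b c x : ℂ) =
      Complex.exp (u * x * Complex.I) * (hermiteGaussian 0 x : ℂ) +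
      a * (Complex.exp (u * x * Complex.I) * (hermiteGaussian 3 x : ℂ)) +
      b * (Complex.exp (u * x * Complex.I) * (hermiteGaussian 4 x : ℂ)) +
      c * (Complex.exp (u * x * Complex.I) * (hermiteGaussian 6 x : ℂ)) := by
    intro x
    simp only [edgeworthDensity]
    push_cast
    ring
  simp_rw [e]
  rw [integral_add ?_ ((i 6).const_mul _), integral_add ?_ ((i 4).const_mul _),
    integral_add (i 0) ((i 3).const_mul _), integral_const_mul, integral_const_mul,
    integral_const_mul]
  · simp_rw [integral_cexp_mul_hermiteGaussian]
    ring
  · exact (i 0).add ((i 3).const_mul _)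
  · exact ((i 0).add ((i 3).const_mul _)).add ((i 4).const_mul _)

lemma integral_edgeworthDensity : ∫ x, edgeworthDensity a b c x = 1 := by
  have h := integral_cexp_mul_edgeworthDensity a b c 0
  simp only [Complex.ofReal_zero, zero_mul, Complex.exp_zero, one_mul] at h
  rw [integral_complex_ofReal] at h
  norm_num at h
  exact_mod_cast h

lemma setIntegral_Iio_edgeworthDensity (s : ℝ) :
    ∫ x in Set.Iio s, edgeworthDensity a b c x =
      cdf (gaussianReal 0 1) s - gaussianPDFReal 0 1 s * (a * (s ^ 2 - 1) + b * (s ^ 3 - 3 * s) +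
        c * (s ^ 5 - 10 * s ^ 3 + 15 * s)) := by
  have i := fun k => (integrable_hermiteGaussian k).integrableOn (s := Set.Iio s)
  simp only [edgeworthDensity]
  rw [integral_add ?_ ((i 6).const_mul _), integral_add ?_ ((i 4).const_mul _),
    integral_add (i 0) ((i 3).const_mul _), integral_const_mul, integral_const_mul,
    integral_const_mul, setIntegral_Iio_hermiteGaussian_zero, setIntegral_Iio_hermiteGaussian_succ,
    setIntegral_Iio_hermiteGaussian_succ, setIntegral_Iio_hermiteGaussian_succ,
    hermiteGaussian_two, hermiteGaussian_three, hermiteGaussian_five]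
  · ring
  · exact (i 0).add ((i 3).const_mul _)
  · exact ((i 0).add ((i 3).const_mul _)).add ((i 4).const_mul _)

end EdgeworthDensity

lemma exists_abs_edgeworthDensity_le : ∃ C : ℝ, 0 < C ∧ ∀ a b c x,
    |edgeworthDensity a b c x| ≤ C * (1 + |a| + |b| + |c|) := by
  obtain ⟨C0, h0, k0⟩ := exists_abs_hermiteGaussian_le 0
  obtain ⟨C3, h3, k3⟩ := exists_abs_hermiteGaussian_le 3
  obtain ⟨C4, h4, k4⟩ := exists_abs_hermiteGaussian_le 4
  obtain ⟨C6, h6, k6⟩ := exists_abs_hermiteGaussian_le 6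
  refine ⟨C0 + C3 + C4 + C6, by positivity, fun a b c x => ?_⟩
  have h : |edgeworthDensity a b c x| ≤ C0 + |a| * C3 + |b| * C4 + |c| * C6 := by
    have t0 := abs_le.1 (k0 x)
    have t : ∀ {r C y : ℝ}, |y| ≤ C → -(|r| * C) ≤ r * y ∧ r * y ≤ |r| * C := fun {r C y} hy =>
      abs_le.1 ((abs_mul r y).le.trans (mul_le_mul_of_nonneg_left hy (abs_nonneg r)))
    have t3 := t (r := a) (k3 x)
    have t4 := t (r := b) (k4 x)
    have t6 := t (r := c) (k6 x)
    rw [edgeworthDensity, abs_le]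
    constructor <;> linarith [t0.1, t0.2, t3.1, t3.2, t4.1, t4.2, t6.1, t6.2]
  refine h.trans ?_
  have : 0 ≤ |a| * (C0 + C4 + C6) + |b| * (C0 + C3 + C6) + |c| * (C0 + C3 + C4) + C3 + C4 + C6 := by
    positivity
  linarith

/-! ### Characteristic functions near the origin -/

/-- A Taylor bound valid for all real `y`, not only for small ones. -/
lemma norm_cexp_mul_I_sub_sum_le (n : ℕ) (y : ℝ) :
    ‖Complex.exp (y * Complex.I) - ∑ k ∈ Finset.range n, (y * Complex.I) ^ k / k.factorial‖ ≤
      (n + 3) * |y| ^ n := by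
  have hy : ‖(y : ℂ) * Complex.I‖ = |y| := by simp
  rcases le_total |y| 1 with h | h
  · refine (Complex.norm_exp_sub_sum_le_norm_mul_exp _ n).trans ?_
    rw [hy, mul_comm]
    refine mul_le_mul_of_nonneg_right ?_ (by positivity)
    have h1 := Real.exp_le_exp.2 h
    have h2 := Real.exp_one_lt_d9
    have h3 : (0 : ℝ) ≤ n := n.cast_nonneg
    linarith
  · have h1 : (1 : ℝ) ≤ |y| ^ n := one_le_pow₀ h
    have h2 : ‖∑ k ∈ Finset.range n, (y * Complex.I) ^ k / (k.factorial : ℂ)‖ ≤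
        ∑ k ∈ Finset.range n, |y| ^ n := by
      refine norm_sum_le_of_le _ fun k hk => ?_
      rw [norm_div, norm_pow, hy, Complex.norm_natCast]
      refine (div_le_self (by positivity) (by exact_mod_cast k.factorial_pos)).trans ?_
      exact pow_le_pow_right₀ h (Finset.mem_range.1 hk).le
    rw [Finset.sum_const, Finset.card_range, nsmul_eq_mul] at h2
    refine (norm_sub_le _ _).trans ?_
    rw [Complex.norm_exp_ofReal_mul_I]
    nlinarith

/-- Taylor expansion of a characteristic function at the origin, with an explicit remainder. -/
lemma norm_charFun_sub_sum_le (F : Measure ℝ) [IsProbabilityMeasure F] (n : ℕ)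
    (hF : Integrable (fun x : ℝ => |x| ^ n) F) (v : ℝ) :
    ‖charFun F v - ∑ k ∈ Finset.range n,
      (v * Complex.I) ^ k / k.factorial * ((∫ x, x ^ k ∂F : ℝ) : ℂ)‖ ≤
      (n + 3) * |v| ^ n * ∫ x, |x| ^ n ∂F := by
  have hk : ∀ k ∈ Finset.range n, Integrable (fun x : ℝ => x ^ k) F := by
    intro k hk
    refine (hF.add (integrable_const (1 : ℝ))).mono' (by fun_prop) (ae_of_all _ fun x => ?_)
    rw [Real.norm_eq_abs, abs_pow]
    simp only [Pi.add_apply]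
    rcases le_total |x| 1 with h | h
    · exact (pow_le_one₀ (abs_nonneg x) h).trans (le_add_of_nonneg_left (by positivity))
    · exact (pow_le_pow_right₀ h (Finset.mem_range.1 hk).le).trans
        (le_add_of_nonneg_right zero_le_one)
  have hk' : ∀ k ∈ Finset.range n, Integrable (fun x : ℝ =>
      (v * Complex.I) ^ k / k.factorial * ((x ^ k : ℝ) : ℂ)) F :=
    fun k h => (hk k h).ofReal.const_mul _
  have he : Integrable (fun x : ℝ => Complex.exp (v * x * Complex.I)) F := by
    refine (integrable_const (1 : ℝ)).mono' (by fun_prop) (ae_of_all _ fun x => ?_)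
    rw [← Complex.ofReal_mul, Complex.norm_exp_ofReal_mul_I]
  have e1 : charFun F v - ∑ k ∈ Finset.range n,
      (v * Complex.I) ^ k / k.factorial * ((∫ x, x ^ k ∂F : ℝ) : ℂ) =
      ∫ x : ℝ, (Complex.exp (v * x * Complex.I) - ∑ k ∈ Finset.range n,
        (v * Complex.I) ^ k / k.factorial * ((x ^ k : ℝ) : ℂ)) ∂F := by
    rw [integral_sub he (integrable_finsetSum _ hk'), integral_finsetSum _ hk',
      charFun_apply_real]
    congr 1
    refine Finset.sum_congr rfl fun k _ => ?_
    rw [integral_const_mul, integral_complex_ofReal]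
  rw [e1, ← integral_const_mul]
  refine norm_integral_le_of_norm_le (hF.const_mul _) (ae_of_all _ fun x => ?_)
  have h := norm_cexp_mul_I_sub_sum_le n (v * x)
  rw [abs_mul, mul_pow, ← mul_assoc] at h
  refine le_trans (le_of_eq ?_) h
  congr 2
  · push_cast
    ring_nf
  · refine Finset.sum_congr rfl fun k _ => ?_
    push_cast
    ring

lemma norm_pow_sub_pow_le {a b : ℂ} {r : ℝ} (ha : ‖a‖ ≤ r) (hb : ‖b‖ ≤ r) (n : ℕ) :
    ‖a ^ (n + 1) - b ^ (n + 1)‖ ≤ (n + 1) * ‖a - b‖ * r ^ n := by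
  have hr : 0 ≤ r := (norm_nonneg a).trans ha
  induction n with
  | zero => simp
  | succ n ih =>
    have e : a ^ (n + 1 + 1) - b ^ (n + 1 + 1) =
        a * (a ^ (n + 1) - b ^ (n + 1)) + (a - b) * b ^ (n + 1) := by ring
    rw [e]
    refine (norm_add_le _ _).trans ?_
    rw [norm_mul, norm_mul, norm_pow]
    have h1 : ‖a‖ * ‖a ^ (n + 1) - b ^ (n + 1)‖ ≤ r * ((n + 1) * ‖a - b‖ * r ^ n) := by gcongr
    have h2 : ‖a - b‖ * ‖b‖ ^ (n + 1) ≤ ‖a - b‖ * r ^ (n + 1) := by gcongr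
    have h3 : r * ((n + 1) * ‖a - b‖ * r ^ n) = (n + 1) * ‖a - b‖ * r ^ (n + 1) := by ring
    push_cast
    linarith

/-- If `f` is close to `exp (-v² / 2 + q)`, then `f ^ n` is close to the product of
`exp (-n v² / 2)` and a partial sum of the exponential series at `n q`. -/
lemma norm_pow_sub_exp_mul_sum_le {f q : ℂ} {v E : ℝ} {n : ℕ} (hn : 2 ≤ n)
    (hf : ‖f‖ ≤ Real.exp (-(v ^ 2 / 4))) (hq : ‖q‖ ≤ v ^ 2 / 8)
    (hE : ‖f - Complex.exp (-(v ^ 2 / 2) + q)‖ ≤ E) (m : ℕ) :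
    ‖f ^ n - Complex.exp (-(n * v ^ 2 / 2)) *
      ∑ k ∈ Finset.range m, (n * q) ^ k / k.factorial‖ ≤
      (n * E + ‖n * q‖ ^ m) * Real.exp (-(n * v ^ 2 / 8)) := by
  have hb : ‖Complex.exp (-(v ^ 2 / 2) + q)‖ ≤ Real.exp (-(v ^ 2 / 4)) := by
    rw [Complex.norm_exp, Real.exp_le_exp]
    have h1 := (Complex.abs_re_le_norm q).trans hq
    have h2 : (-((v : ℂ) ^ 2 / 2) + q).re = -(v ^ 2 / 2) + q.re := by
      rw [Complex.add_re, ← Complex.ofReal_pow]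
      norm_num [← Complex.ofReal_pow]
    rw [h2]
    have := (abs_le.1 h1).2
    nlinarith [sq_nonneg v]
  have hE0 : 0 ≤ E := (norm_nonneg _).trans hE
  obtain ⟨p, rfl⟩ : ∃ p, n = p + 1 := ⟨n - 1, by omega⟩
  have h1 : ‖f ^ (p + 1) - Complex.exp (-(v ^ 2 / 2) + q) ^ (p + 1)‖ ≤
      (p + 1 : ℕ) * E * Real.exp (-((p + 1 : ℕ) * v ^ 2 / 8)) := by
    refine (norm_pow_sub_pow_le hf hb p).trans ?_
    rw [← Real.exp_nat_mul]
    push_cast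
    have hp : (1 : ℝ) ≤ p := by exact_mod_cast (by omega : 1 ≤ p)
    refine mul_le_mul (by gcongr) (Real.exp_le_exp.2 ?_) (Real.exp_pos _).le (by positivity)
    nlinarith [sq_nonneg v]
  have h2 : Complex.exp (-(v ^ 2 / 2) + q) ^ (p + 1) =
      Complex.exp (-((p + 1 : ℕ) * v ^ 2 / 2)) * Complex.exp ((p + 1 : ℕ) * q) := by
    rw [← Complex.exp_nat_mul, ← Complex.exp_add]
    congr 1
    ring
  have h3 : ‖Complex.exp (-(v ^ 2 / 2) + q) ^ (p + 1) - Complex.exp (-((p + 1 : ℕ) * v ^ 2 / 2)) *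
      ∑ k ∈ Finset.range m, ((p + 1 : ℕ) * q) ^ k / k.factorial‖ ≤
      ‖(p + 1 : ℕ) * q‖ ^ m * Real.exp (-((p + 1 : ℕ) * v ^ 2 / 8)) := by
    rw [h2, ← mul_sub, norm_mul]
    have h4 := Complex.norm_exp_sub_sum_le_norm_mul_exp ((p + 1 : ℕ) * q) m
    have h5 : ‖Complex.exp (-((p + 1 : ℕ) * v ^ 2 / 2))‖ =
        Real.exp (-((p + 1 : ℕ) * v ^ 2 / 2)) := by
      rw [Complex.norm_exp]
      congr 1
      rw [← Complex.ofReal_pow, ← Complex.ofReal_natCast, ← Complex.ofReal_mul]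
      norm_num [← Complex.ofReal_mul, ← Complex.ofReal_pow]
    have h6 : ‖((p + 1 : ℕ) : ℂ) * q‖ ≤ (p + 1 : ℕ) * v ^ 2 / 8 := by
      rw [norm_mul, Complex.norm_natCast, mul_div_assoc]
      gcongr
    rw [h5]
    refine (mul_le_mul_of_nonneg_left h4 (Real.exp_pos _).le).trans ?_
    rw [mul_left_comm, ← Real.exp_add]
    refine mul_le_mul_of_nonneg_left (Real.exp_le_exp.2 ?_) (by positivity)
    have : (0 : ℝ) ≤ (p + 1 : ℕ) * v ^ 2 := by positivity
    linarith
  rw [add_mul]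
  refine le_trans ?_ (add_le_add h1 h3)
  refine le_trans (le_of_eq ?_) (norm_add_le _ _)
  congr 1
  ring

/-- A characteristic function with a third-order expansion has Gaussian decay near the origin. -/
lemma norm_le_exp_of_expansion {f : ℂ} {ρ K v : ℝ} (hK : 1 ≤ K) (hρ : |ρ| ≤ K)
    (hv : 8 * K * |v| ≤ 1)
    (hf : ‖f - (1 - v ^ 2 / 2 + ρ / 6 * (v * Complex.I) ^ 3)‖ ≤ K * v ^ 4) :
    ‖f‖ ≤ Real.exp (-(v ^ 2 / 4)) := by
  have hv1 : |v| ≤ 1 := by nlinarith [abs_nonneg v]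
  have hv2 : v ^ 2 ≤ 1 := by rw [← sq_abs]; nlinarith [abs_nonneg v]
  have h1 : ‖(1 : ℂ) - v ^ 2 / 2‖ = 1 - v ^ 2 / 2 := by
    rw [← Complex.ofReal_pow, ← Complex.ofReal_one, ← Complex.ofReal_ofNat, ← Complex.ofReal_div,
      ← Complex.ofReal_sub, Complex.norm_real, Real.norm_of_nonneg (by linarith)]
  have h2 : ‖(ρ : ℂ) / 6 * (v * Complex.I) ^ 3‖ ≤ K / 6 * |v| ^ 3 := by
    simp only [norm_mul, norm_div, norm_pow, Complex.norm_real, Complex.norm_I, mul_one,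
      Real.norm_eq_abs, Complex.norm_ofNat]
    gcongr
  have h3 : ‖f‖ ≤ K * v ^ 4 + ((1 - v ^ 2 / 2) + K / 6 * |v| ^ 3) := by
    rw [← h1]
    have e : f = (f - (1 - v ^ 2 / 2 + ρ / 6 * (v * Complex.I) ^ 3)) +
      ((1 - v ^ 2 / 2) + ρ / 6 * (v * Complex.I) ^ 3) := by ring
    rw [e]
    exact (norm_add_le _ _).trans (add_le_add hf ((norm_add_le _ _).trans (by gcongr)))
  have h4 : K * |v| ^ 3 ≤ v ^ 2 / 8 := by
    rw [← sq_abs v]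
    nlinarith [mul_le_mul_of_nonneg_right hv (sq_nonneg |v|)]
  have h5 : K * v ^ 4 ≤ K * |v| ^ 3 := by
    have : v ^ 4 = |v| ^ 3 * |v| := by rw [← pow_succ, Even.pow_abs (by decide)]
    rw [this]
    have := mul_le_of_le_one_right (by positivity : 0 ≤ |v| ^ 3) hv1
    gcongr
  have h6 := Real.add_one_le_exp (-(v ^ 2 / 4))
  nlinarith

lemma norm_charFun_sub_le_four (F : Measure ℝ) [IsProbabilityMeasure F] {ρ : ℝ}
    (hF : Integrable (fun x : ℝ => x ^ 4) F) (h1 : ∫ x, x ∂F = 0) (h2 : ∫ x, x ^ 2 ∂F = 1)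
    (h3 : ∫ x, x ^ 3 ∂F = ρ) (v : ℝ) :
    ‖charFun F v - (1 - v ^ 2 / 2 + ρ / 6 * (v * Complex.I) ^ 3)‖ ≤
      7 * (∫ x, x ^ 4 ∂F) * v ^ 4 := by
  have e : ∀ x : ℝ, |x| ^ 4 = x ^ 4 := fun x => Even.pow_abs (by decide) x
  have h := norm_charFun_sub_sum_le F 4 (by simpa only [e] using hF) v
  simp only [e, Finset.sum_range_succ, Finset.sum_range_zero, pow_one, pow_zero, h1, h2, h3,
    integral_const, probReal_univ] at h
  refine le_trans (le_of_eq ?_) (h.trans (le_of_eq ?_))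
  · congr 2
    simp [Nat.factorial, mul_pow]
    ring
  · push_cast
    ring

lemma norm_charFun_sub_le_five (F : Measure ℝ) [IsProbabilityMeasure F] {ρ κ : ℝ}
    (hF : Integrable (fun x : ℝ => |x| ^ 5) F) (h1 : ∫ x, x ∂F = 0) (h2 : ∫ x, x ^ 2 ∂F = 1)
    (h3 : ∫ x, x ^ 3 ∂F = ρ) (h4 : ∫ x, x ^ 4 ∂F = κ + 3) (v : ℝ) :
    ‖charFun F v - (1 - v ^ 2 / 2 + ρ / 6 * (v * Complex.I) ^ 3 + (κ + 3) / 24 * v ^ 4)‖ ≤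
      8 * (∫ x, |x| ^ 5 ∂F) * |v| ^ 5 := by
  have h := norm_charFun_sub_sum_le F 5 hF v
  simp only [Finset.sum_range_succ, Finset.sum_range_zero, pow_one, pow_zero, h1, h2, h3, h4,
    integral_const, probReal_univ] at h
  refine le_trans (le_of_eq ?_) (h.trans (le_of_eq ?_))
  · congr 2
    simp [Nat.factorial, mul_pow]
    ring
  · push_cast
    ring

lemma norm_cexp_neg_sq_add_sub_sum_le {q : ℂ} {v : ℝ} (hv : |v| ≤ 1) (hq : ‖q‖ ≤ v ^ 2 / 8)
    (m : ℕ) :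
    ‖Complex.exp (-(v ^ 2 / 2) + q) -
      ∑ k ∈ Finset.range m, (-(v ^ 2 / 2) + q) ^ k / k.factorial‖ ≤ 3 * |v| ^ (2 * m) := by
  have h1 : ‖-((v : ℂ) ^ 2 / 2) + q‖ ≤ |v| ^ 2 := by
    refine (norm_add_le _ _).trans ?_
    rw [norm_neg, norm_div, norm_pow, Complex.norm_real, Real.norm_eq_abs, Complex.norm_ofNat]
    rw [← sq_abs] at hq
    nlinarith [sq_nonneg |v|]
  have h2 : ‖-((v : ℂ) ^ 2 / 2) + q‖ ≤ 1 := h1.trans (pow_le_one₀ (abs_nonneg v) hv)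
  refine (Complex.norm_exp_sub_sum_le_norm_mul_exp _ m).trans ?_
  rw [mul_comm, pow_mul]
  have h3 : Real.exp ‖-((v : ℂ) ^ 2 / 2) + q‖ ≤ 3 :=
    (Real.exp_le_exp.2 h2).trans (Real.exp_one_lt_d9.le.trans (by norm_num))
  gcongr

lemma norm_cubic_le {ρ K v : ℝ} (hρ : |ρ| ≤ K) :
    ‖(ρ : ℂ) / 6 * (v * Complex.I) ^ 3‖ ≤ K * |v| ^ 3 / 6 := by
  simp only [norm_mul, norm_div, norm_pow, Complex.norm_real, Complex.norm_I, mul_one,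
    Real.norm_eq_abs, Complex.norm_ofNat]
  rw [div_mul_eq_mul_div]
  gcongr

lemma norm_pow_sub_le_of_expansion_four {f : ℂ} {ρ K v : ℝ} {n : ℕ} (hn : 2 ≤ n) (hK : 1 ≤ K)
    (hρ : |ρ| ≤ K) (hv : 8 * K * |v| ≤ 1)
    (hf : ‖f - (1 - v ^ 2 / 2 + ρ / 6 * (v * Complex.I) ^ 3)‖ ≤ K * v ^ 4) :
    ‖f ^ n - Complex.exp (-(n * v ^ 2 / 2)) * (1 + n * (ρ / 6 * (v * Complex.I) ^ 3))‖ ≤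
      (n * (4 * K * |v| ^ 4) + (n * (K * |v| ^ 3)) ^ 2) * Real.exp (-(n * v ^ 2 / 8)) := by
  have hv1 : |v| ≤ 1 := by nlinarith [abs_nonneg v]
  have h4 : K * |v| ^ 3 ≤ v ^ 2 / 8 := by
    rw [← sq_abs v]
    nlinarith [mul_le_mul_of_nonneg_right hv (sq_nonneg |v|)]
  have hp : 0 ≤ K * |v| ^ 3 := by positivity
  set q : ℂ := ρ / 6 * (v * Complex.I) ^ 3 with hqdef
  have hq' : ‖q‖ ≤ K * |v| ^ 3 := (norm_cubic_le hρ).trans (by linarith)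
  have hE : ‖f - Complex.exp (-(v ^ 2 / 2) + q)‖ ≤ 4 * K * |v| ^ 4 := by
    have h5 := norm_cexp_neg_sq_add_sub_sum_le hv1 (hq'.trans h4) 2
    simp only [Finset.sum_range_succ, Finset.sum_range_zero] at h5
    rw [norm_sub_rev] at h5
    have e : f - Complex.exp (-(v ^ 2 / 2) + q) = (f - (1 - v ^ 2 / 2 + q)) +
      (0 + (-(v ^ 2 / 2) + q) ^ 0 / (0).factorial + (-(v ^ 2 / 2) + q) ^ 1 / (1).factorial -
        Complex.exp (-(v ^ 2 / 2) + q)) := by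
      simp
      ring
    have e2 : v ^ 4 = |v| ^ 4 := (Even.pow_abs (by decide) v).symm
    rw [e]
    refine (norm_add_le _ _).trans ((add_le_add hf h5).trans ?_)
    rw [e2]
    have : 0 ≤ |v| ^ 4 := by positivity
    norm_num
    nlinarith
  have h := norm_pow_sub_exp_mul_sum_le hn (norm_le_exp_of_expansion hK hρ hv hf)
    (hq'.trans h4) hE 2
  simp only [Finset.sum_range_succ, Finset.sum_range_zero] at h
  refine le_trans (le_of_eq ?_) (h.trans ?_)
  · congr 2
    simp
  · refine mul_le_mul_of_nonneg_right ?_ (Real.exp_pos _).le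
    rw [norm_mul, Complex.norm_natCast]
    gcongr

lemma norm_pow_sub_le_of_expansion_five {f : ℂ} {ρ κ K v : ℝ} {n : ℕ} (hn : 2 ≤ n) (hK : 1 ≤ K)
    (hρ : |ρ| ≤ K) (hκ : |κ| ≤ K) (hv : 8 * K * |v| ≤ 1)
    (hf : ‖f - (1 - v ^ 2 / 2 + ρ / 6 * (v * Complex.I) ^ 3)‖ ≤ K * v ^ 4)
    (hf' : ‖f - (1 - v ^ 2 / 2 + ρ / 6 * (v * Complex.I) ^ 3 + (κ + 3) / 24 * v ^ 4)‖ ≤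
      K * |v| ^ 5) :
    ‖f ^ n - Complex.exp (-(n * v ^ 2 / 2)) * (1 + n * (ρ / 6 * (v * Complex.I) ^ 3) +
      n * (κ / 24 * v ^ 4) + (n * ρ) ^ 2 / 72 * (v * Complex.I) ^ 6)‖ ≤
      (n * (5 * K ^ 2 * |v| ^ 5) + (n * (K * |v| ^ 3)) ^ 3 + n ^ 2 * K ^ 2 * |v| ^ 7) *
        Real.exp (-(n * v ^ 2 / 8)) := by
  have hv1 : |v| ≤ 1 := by nlinarith [abs_nonneg v]
  have h4 : K * |v| ^ 3 ≤ v ^ 2 / 8 := by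
    rw [← sq_abs v]
    nlinarith [mul_le_mul_of_nonneg_right hv (sq_nonneg |v|)]
  have hp : 0 ≤ K * |v| ^ 3 := by positivity
  have p76 : |v| ^ 6 ≤ |v| ^ 5 := pow_le_pow_of_le_one (abs_nonneg v) hv1 (by norm_num)
  have p87 : |v| ^ 8 ≤ |v| ^ 7 := pow_le_pow_of_le_one (abs_nonneg v) hv1 (by norm_num)
  have p43 : |v| ^ 4 ≤ |v| ^ 3 := pow_le_pow_of_le_one (abs_nonneg v) hv1 (by norm_num)
  have p5 : 0 ≤ |v| ^ 5 := by positivity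
  have p7 : 0 ≤ |v| ^ 7 := by positivity
  set c : ℂ := ρ / 6 * (v * Complex.I) ^ 3 with hcdef
  set d : ℂ := κ / 24 * v ^ 4 with hddef
  have hc : ‖c‖ ≤ K * |v| ^ 3 / 6 := norm_cubic_le hρ
  have hd : ‖d‖ ≤ K * |v| ^ 4 / 24 := by
    simp only [hddef, norm_mul, norm_div, norm_pow, Complex.norm_real, Real.norm_eq_abs,
      Complex.norm_ofNat]
    rw [div_mul_eq_mul_div]
    gcongr
  have hd' : ‖d‖ ≤ K * |v| ^ 3 / 24 := hd.trans (by gcongr)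
  set q : ℂ := c + d with hqdef
  have hq' : ‖q‖ ≤ K * |v| ^ 3 := (norm_add_le _ _).trans (by linarith)
  have hE : ‖f - Complex.exp (-(v ^ 2 / 2) + q)‖ ≤ 5 * K ^ 2 * |v| ^ 5 := by
    have h5 := norm_cexp_neg_sq_add_sub_sum_le hv1 (hq'.trans h4) 3
    simp only [Finset.sum_range_succ, Finset.sum_range_zero] at h5
    rw [norm_sub_rev] at h5
    have e : f - Complex.exp (-(v ^ 2 / 2) + q) = (f - (1 - v ^ 2 / 2 + c + (κ + 3) / 24 * v ^ 4)) +
      (0 + (-(v ^ 2 / 2) + q) ^ 0 / (0).factorial + (-(v ^ 2 / 2) + q) ^ 1 / (1).factorial +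
        (-(v ^ 2 / 2) + q) ^ 2 / (2).factorial - Complex.exp (-(v ^ 2 / 2) + q)) +
        (v ^ 2 / 2 * q - q ^ 2 / 2) := by
      simp [hqdef, hddef]
      ring
    have h6 : ‖(v : ℂ) ^ 2 / 2 * q - q ^ 2 / 2‖ ≤
        |v| ^ 2 / 2 * (K * |v| ^ 3) + (K * |v| ^ 3) ^ 2 / 2 := by
      refine (norm_sub_le _ _).trans ?_
      simp only [norm_mul, norm_div, norm_pow, Complex.norm_real, Real.norm_eq_abs,
        Complex.norm_ofNat]
      gcongr
    rw [e]
    refine (norm_add_le _ _).trans ((add_le_add ((norm_add_le _ _).trans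
      (add_le_add hf' h5)) h6).trans ?_)
    have hK2 : K ≤ K ^ 2 := by nlinarith
    have h7 : K * |v| ^ 5 ≤ K ^ 2 * |v| ^ 5 := by gcongr
    have h8 : |v| ^ 5 ≤ K ^ 2 * |v| ^ 5 := le_mul_of_one_le_left p5 (hK.trans hK2)
    have h9 : K ^ 2 * |v| ^ 6 ≤ K ^ 2 * |v| ^ 5 := by gcongr
    rw [show 2 * 3 = 6 by norm_num]
    linarith
  have h := norm_pow_sub_exp_mul_sum_le hn (norm_le_exp_of_expansion hK hρ hv hf)
    (hq'.trans h4) hE 3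
  simp only [Finset.sum_range_succ, Finset.sum_range_zero] at h
  have hr : ‖(n : ℂ) ^ 2 * (c * d + d ^ 2 / 2)‖ ≤ n ^ 2 * K ^ 2 * |v| ^ 7 := by
    rw [norm_mul, norm_pow, Complex.norm_natCast, mul_assoc ((n : ℝ) ^ 2)]
    suffices h : ‖c * d + d ^ 2 / 2‖ ≤ K ^ 2 * |v| ^ 7 from
      mul_le_mul_of_nonneg_left h (by positivity)
    have h10 : ‖c * d + d ^ 2 / 2‖ ≤ K * |v| ^ 3 / 6 * (K * |v| ^ 4 / 24) +
        (K * |v| ^ 4 / 24) ^ 2 / 2 := by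
      refine (norm_add_le _ _).trans ?_
      simp only [norm_mul, norm_div, norm_pow, Complex.norm_ofNat]
      gcongr
    have h11 : K ^ 2 * |v| ^ 8 ≤ K ^ 2 * |v| ^ 7 := by gcongr
    have h12 : 0 ≤ K ^ 2 * |v| ^ 7 := by positivity
    linarith
  have hexp : ‖Complex.exp (-(n * v ^ 2 / 2))‖ ≤ Real.exp (-(n * v ^ 2 / 8)) := by
    rw [Complex.norm_exp, Real.exp_le_exp, ← Complex.ofReal_pow, ← Complex.ofReal_natCast,
      ← Complex.ofReal_mul]
    norm_num [← Complex.ofReal_mul, ← Complex.ofReal_pow]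
    have : (0 : ℝ) ≤ n * v ^ 2 := by positivity
    linarith
  have e3 : f ^ n - Complex.exp (-(n * v ^ 2 / 2)) * (1 + n * c +
      n * d + (n * ρ) ^ 2 / 72 * (v * Complex.I) ^ 6) =
      (f ^ n - Complex.exp (-(n * v ^ 2 / 2)) * (0 + (n * q) ^ 0 / (0).factorial +
        (n * q) ^ 1 / (1).factorial + (n * q) ^ 2 / (2).factorial)) +
      Complex.exp (-(n * v ^ 2 / 2)) * (n ^ 2 * (c * d + d ^ 2 / 2)) := by
    -- the `(n * q) ^ 2 / 2` term contributes the square of the skewness at this order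
    have hc2 : (n * ρ) ^ 2 / 72 * (v * Complex.I) ^ 6 = n ^ 2 * (c ^ 2 / 2) := by
      rw [hcdef]
      ring
    rw [hc2, hqdef]
    simp
    ring
  rw [e3]
  refine (norm_add_le _ _).trans ((add_le_add h (norm_mul_le _ _)).trans ?_)
  have h13 : ‖(n : ℂ) * q‖ ≤ n * (K * |v| ^ 3) := by
    rw [norm_mul, Complex.norm_natCast]
    gcongr
  have h14 := mul_le_mul hexp hr (norm_nonneg _) (Real.exp_pos _).le
  rw [add_mul _ ((n : ℝ) ^ 2 * K ^ 2 * |v| ^ 7), mul_comm ((n : ℝ) ^ 2 * K ^ 2 * |v| ^ 7)]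
  refine add_le_add ?_ h14
  gcongr

/-! ### Smoothing against the Edgeworth expansion -/

lemma integrable_one_add_pow_mul_exp :
    Integrable fun u : ℝ => (1 + u ^ 12) * Real.exp (-(u ^ 2 / 8)) := by
  have h0 := integrable_exp_neg_mul_sq (b := 1 / 8) (by norm_num)
  have h := integrable_rpow_mul_exp_neg_mul_sq (b := 1 / 8) (by norm_num) (s := (12 : ℕ))
    (by norm_num)
  simp_rw [Real.rpow_natCast] at h
  refine (h0.add h).congr (ae_of_all _ fun u => ?_)
  have e : -(1 / 8) * u ^ 2 = -(u ^ 2 / 8) := by ring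
  simp only [Pi.add_apply, e]
  ring

/-- All powers of `u` that occur in the error terms are absorbed in the single majorant
`u * (1 + u ^ 12)`; the factor `u` cancels the `1 / u` of the smoothing inequality. -/
lemma pow_le_mul_one_add_pow {u : ℝ} (hu : 0 ≤ u) {j : ℕ} (hj : j ≤ 12) :
    u ^ (j + 1) ≤ u * (1 + u ^ 12) := by
  rw [pow_succ']
  refine mul_le_mul_of_nonneg_left ?_ hu
  rcases le_total u 1 with h | h
  · exact (pow_le_one₀ hu h).trans (le_add_of_nonneg_right (by positivity))
  · exact (pow_le_pow_right₀ h hj).trans (le_add_of_nonneg_left zero_le_one)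

/-- The smoothing inequality for the Edgeworth expansion, with the bound on the difference of the
Fourier transforms already integrated. -/
lemma exists_abs_sub_edgeworth_le : ∃ C : ℝ, 0 < C ∧ ∀ (μ : Measure ℝ) [IsProbabilityMeasure μ]
    (_ : Integrable (fun x : ℝ => x) μ) (a b c L R T : ℝ) (_ : 0 < T) (_ : 0 ≤ L) (_ : 0 ≤ R)
    (_ : ∀ u : ℝ, 0 < u → u ≤ T → ‖charFun μ u - Complex.exp (-(u ^ 2 / 2)) *
      (1 + a * (u * Complex.I) ^ 3 + b * (u * Complex.I) ^ 4 + c * (u * Complex.I) ^ 6)‖ ≤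
      u * (L * ((1 + u ^ 12) * Real.exp (-(u ^ 2 / 8))) + R)) (s : ℝ),
    |μ.real (Set.Iio s) - ∫ x in Set.Iio s, edgeworthDensity a b c x| ≤
      C * (L + R * T + (1 + |a| + |b| + |c|) / T) := by
  obtain ⟨C, hC, h⟩ := exists_smoothing_const
  obtain ⟨C', hC', h'⟩ := exists_abs_edgeworthDensity_le
  set Φ : ℝ → ℝ := fun u => (1 + u ^ 12) * Real.exp (-(u ^ 2 / 8)) with hΦ
  have hΦi : Integrable Φ := integrable_one_add_pow_mul_exp
  have hΦ0 : ∀ u, 0 ≤ Φ u := fun u => by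
    have : 0 ≤ u ^ 12 := Even.pow_nonneg (by decide) u
    positivity
  set J := ∫ u, Φ u with hJ
  have hJ0 : 0 ≤ J := integral_nonneg hΦ0
  refine ⟨C * (J + 1 + C'), by positivity, ?_⟩
  intro μ _ hμ a b c L R T hT hL hR hub s
  have hi1 : IntervalIntegrable (fun u => L * Φ u) volume 0 T :=
    (hΦi.const_mul L).intervalIntegrable
  have hi2 : IntervalIntegrable (fun _ : ℝ => R) volume 0 T := intervalIntegrable_const
  have h1 := h μ hμ (edgeworthDensity a b c) (C' * (1 + |a| + |b| + |c|))
    (integrable_edgeworthDensity a b c) (integrable_mul_edgeworthDensity a b c)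
    (integral_edgeworthDensity a b c) (h' a b c) T hT (fun u => L * Φ u + R) (hi1.add hi2)
    (by
      intro u hu huT
      rw [integral_cexp_mul_edgeworthDensity]
      exact hub u hu huT) s
  refine h1.trans ?_
  have h2 : ∫ u in (0 : ℝ)..T, (L * Φ u + R) ≤ L * J + R * T := by
    rw [intervalIntegral.integral_add hi1 hi2, intervalIntegral.integral_const_mul,
      intervalIntegral.integral_const, sub_zero, smul_eq_mul, mul_comm T,
      intervalIntegral.integral_of_le hT.le]
    have := setIntegral_le_integral (s := Set.Ioc 0 T) hΦi (ae_of_all _ hΦ0)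
    gcongr
  have hRT : 0 ≤ R * T := by positivity
  set Q := (1 + |a| + |b| + |c|) / T with hQ
  have hQ0 : 0 ≤ Q := by positivity
  have e : C' * (1 + |a| + |b| + |c|) / T = C' * Q := by rw [hQ]; ring
  rw [e, mul_assoc]
  refine mul_le_mul_of_nonneg_left ?_ hC.le
  have h3 : 0 ≤ J * (R * T + Q) + (L + Q) + C' * (L + R * T) := by positivity
  linarith

/-- The characteristic function of a normalized sum against the first-order expansion, on a
range where `‖f‖ ≤ c` away from the origin. Beyond the range of the Taylor expansion the factor
`8 * K * u / √n ≥ 1` supplies the powers of `√n`. -/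
lemma norm_pow_sub_le_first_order {f : ℝ → ℂ} {ρ K A c : ℝ} (hK : 1 ≤ K) (hρ : |ρ| ≤ K)
    (hf : ∀ v : ℝ, ‖f v - (1 - v ^ 2 / 2 + ρ / 6 * (v * Complex.I) ^ 3)‖ ≤ K * v ^ 4)
    (hc0 : 0 ≤ c) (hc : ∀ v, (8 * K)⁻¹ ≤ v → v ≤ A → ‖f v‖ ≤ c) {n : ℕ} (hn : 2 ≤ n) {u : ℝ}
    (hu : 0 < u) (huA : u ≤ A * √n) :
    ‖f ((√n)⁻¹ * u) ^ n - Complex.exp (-(u ^ 2 / 2)) *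
      (1 + (ρ / (6 * √n) : ℝ) * (u * Complex.I) ^ 3)‖ ≤
      u * (128 * K ^ 3 / √n ^ 2 * ((1 + u ^ 12) * Real.exp (-(u ^ 2 / 8))) + 8 * K * c ^ n) := by
  have hn0 : (0 : ℝ) < n := by exact_mod_cast (by omega : 0 < n)
  have hn1 : (1 : ℝ) ≤ n := by exact_mod_cast (by omega : 1 ≤ n)
  set N := √(n : ℝ) with hN
  have hN0 : 0 < N := Real.sqrt_pos.2 hn0
  have hN1 : 1 ≤ N := Real.one_le_sqrt.2 hn1
  have hNn : (n : ℝ) = N ^ 2 := (Real.sq_sqrt hn0.le).symm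
  have hNc : (n : ℂ) = (N : ℂ) ^ 2 := by exact_mod_cast congrArg Complex.ofReal hNn
  have hNc0 : (N : ℂ) ≠ 0 := by exact_mod_cast hN0.ne'
  set v := N⁻¹ * u with hv
  have hv0 : 0 < v := by positivity
  have huv : u = N * v := by rw [hv]; field_simp
  have hP : ∀ j ≤ 12, u ^ (j + 1) ≤ u * (1 + u ^ 12) := fun j hj =>
    pow_le_mul_one_add_pow hu.le hj
  set P := u * (1 + u ^ 12) with hPdef
  have hP0 : 0 ≤ P := by positivity
  have hgoal : u * (128 * K ^ 3 / N ^ 2 * ((1 + u ^ 12) * Real.exp (-(u ^ 2 / 8))) +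
      8 * K * c ^ n) = 128 * K ^ 3 * P / N ^ 2 * Real.exp (-(u ^ 2 / 8)) + 8 * K * u * c ^ n := by
    rw [hPdef]; ring
  rw [hgoal]
  have hrest : 0 ≤ 8 * K * u * c ^ n := by positivity
  rcases le_total v (8 * K)⁻¹ with h | h
  · have hKv : 8 * K * |v| ≤ 1 := by
      rw [abs_of_pos hv0]
      rwa [le_inv_comm₀ hv0 (by positivity), ← one_div, le_div_iff₀ hv0] at h
    have h1 := norm_pow_sub_le_of_expansion_four hn hK hρ hKv (hf v)
    rw [abs_of_pos hv0] at h1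
    refine (le_of_eq ?_).trans (h1.trans ((le_of_eq ?_).trans (add_le_add (a := (4 * K * u ^ 4 +
      K ^ 2 * u ^ 6) / N ^ 2 * Real.exp (-(u ^ 2 / 8))) (c := 0) ?_ hrest)))
    · rw [hNc, huv]
      congr 4
      · push_cast
        ring
      · push_cast
        field_simp
    · rw [hNn, huv, add_zero]
      congr 1
      · field_simp
      · congr 1
        ring
    · have h4 := hP 3 (by norm_num)
      have h6 := hP 5 (by norm_num)
      have hK3 : K ≤ K ^ 3 := le_self_pow₀ hK (by norm_num)
      have hK23 : K ^ 2 ≤ K ^ 3 := pow_le_pow_right₀ hK (by norm_num)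
      have h7 : K * u ^ 4 ≤ K ^ 3 * P := by gcongr
      have h8 : K ^ 2 * u ^ 6 ≤ K ^ 3 * P := by gcongr
      have h9 : 0 ≤ K ^ 3 * P := by positivity
      gcongr
      linarith
  · have hKu : 1 ≤ 8 * K * v := by
      rwa [inv_le_iff_one_le_mul₀ (by positivity), mul_comm] at h
    have hKu' : 1 ≤ 8 * K * u := hKu.trans (by
      rw [huv]
      have := le_mul_of_one_le_left hv0.le hN1
      gcongr)
    have h1 : ‖f v ^ n‖ ≤ 8 * K * u * c ^ n := by
      rw [norm_pow]
      have h2 := hc v h (by rw [hv, inv_mul_le_iff₀ hN0]; linarith)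
      exact (pow_le_pow_left₀ (norm_nonneg _) h2 n).trans
        (le_mul_of_one_le_left (by positivity) hKu')
    have h3 : ‖Complex.exp (-(u ^ 2 / 2))‖ ≤ Real.exp (-(u ^ 2 / 8)) := by
      rw [Complex.norm_exp, Real.exp_le_exp, ← Complex.ofReal_pow]
      norm_num [← Complex.ofReal_pow]
      nlinarith [sq_nonneg u]
    have h4 : ‖(1 : ℂ) + (ρ / (6 * N) : ℝ) * (u * Complex.I) ^ 3‖ ≤ K * (1 + u ^ 3) := by
      refine (norm_add_le _ _).trans ?_
      simp only [norm_mul, norm_pow, Complex.norm_real, Complex.norm_I, mul_one,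
        Real.norm_eq_abs, abs_of_pos hu, norm_one, mul_add]
      refine add_le_add hK (mul_le_mul_of_nonneg_right ?_ (by positivity))
      rw [abs_div, abs_of_pos (by positivity : 0 < 6 * N)]
      exact (div_le_self (abs_nonneg _) (by linarith)).trans hρ
    have h5 : K * (1 + u ^ 3) ≤ 128 * K ^ 3 * P / N ^ 2 := by
      have h6 : K * (1 + u ^ 3) ≤ K * (1 + u ^ 3) * (8 * K * v) ^ 2 :=
        le_mul_of_one_le_right (by positivity) (one_le_pow₀ hKu)
      refine h6.trans ?_
      have e : K * (1 + u ^ 3) * (8 * K * v) ^ 2 = 64 * K ^ 3 * (u ^ 2 + u ^ 5) / N ^ 2 := by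
        rw [hv]; field_simp; ring
      rw [e]
      have h7 := hP 1 (by norm_num)
      have h8 := hP 4 (by norm_num)
      have h9 : 64 * K ^ 3 * (u ^ 2 + u ^ 5) ≤ 64 * K ^ 3 * (P + P) := by gcongr
      exact div_le_div_of_nonneg_right (h9.trans (by linarith)) (by positivity)
    refine (norm_sub_le _ _).trans ((add_comm _ _).le.trans (add_le_add ?_ h1))
    rw [norm_mul, mul_comm]
    exact mul_le_mul (h4.trans h5) h3 (norm_nonneg _) (by positivity)

/-- The second-order counterpart of `norm_pow_sub_le_first_order`. -/
lemma norm_pow_sub_le_second_order {f : ℝ → ℂ} {ρ κ K c : ℝ} (hK : 1 ≤ K) (hρ : |ρ| ≤ K)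
    (hκ : |κ| ≤ K)
    (hf : ∀ v : ℝ, ‖f v - (1 - v ^ 2 / 2 + ρ / 6 * (v * Complex.I) ^ 3)‖ ≤ K * v ^ 4)
    (hf' : ∀ v : ℝ, ‖f v - (1 - v ^ 2 / 2 + ρ / 6 * (v * Complex.I) ^ 3 +
      (κ + 3) / 24 * v ^ 4)‖ ≤ K * |v| ^ 5)
    (hc0 : 0 ≤ c) (hc : ∀ v, (8 * K)⁻¹ ≤ v → ‖f v‖ ≤ c) {n : ℕ} (hn : 2 ≤ n) {u : ℝ}
    (hu : 0 < u) :
    ‖f ((√n)⁻¹ * u) ^ n - Complex.exp (-(u ^ 2 / 2)) *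
      (1 + (ρ / (6 * √n) : ℝ) * (u * Complex.I) ^ 3 + (κ / (24 * n) : ℝ) * (u * Complex.I) ^ 4 +
        (ρ ^ 2 / (72 * n) : ℝ) * (u * Complex.I) ^ 6)‖ ≤
      u * (2048 * K ^ 5 / √n ^ 3 * ((1 + u ^ 12) * Real.exp (-(u ^ 2 / 8))) + 8 * K * c ^ n) := by
  have hn0 : (0 : ℝ) < n := by exact_mod_cast (by omega : 0 < n)
  have hn1 : (1 : ℝ) ≤ n := by exact_mod_cast (by omega : 1 ≤ n)
  set N := √(n : ℝ) with hN
  have hN0 : 0 < N := Real.sqrt_pos.2 hn0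
  have hN1 : 1 ≤ N := Real.one_le_sqrt.2 hn1
  have hNn : (n : ℝ) = N ^ 2 := (Real.sq_sqrt hn0.le).symm
  have hNc : (n : ℂ) = (N : ℂ) ^ 2 := by exact_mod_cast congrArg Complex.ofReal hNn
  have hNc0 : (N : ℂ) ≠ 0 := by exact_mod_cast hN0.ne'
  set v := N⁻¹ * u with hv
  have hv0 : 0 < v := by positivity
  have huv : u = N * v := by rw [hv]; field_simp
  have hP : ∀ j ≤ 12, u ^ (j + 1) ≤ u * (1 + u ^ 12) := fun j hj =>
    pow_le_mul_one_add_pow hu.le hj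
  set P := u * (1 + u ^ 12) with hPdef
  have hP0 : 0 ≤ P := by positivity
  have hgoal : u * (2048 * K ^ 5 / N ^ 3 * ((1 + u ^ 12) * Real.exp (-(u ^ 2 / 8))) +
      8 * K * c ^ n) = 2048 * K ^ 5 * P / N ^ 3 * Real.exp (-(u ^ 2 / 8)) + 8 * K * u * c ^ n := by
    rw [hPdef]; ring
  rw [hgoal]
  have hrest : 0 ≤ 8 * K * u * c ^ n := by positivity
  rcases le_total v (8 * K)⁻¹ with h | h
  · have hKv : 8 * K * |v| ≤ 1 := by
      rw [abs_of_pos hv0]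
      rwa [le_inv_comm₀ hv0 (by positivity), ← one_div, le_div_iff₀ hv0] at h
    have h1 := norm_pow_sub_le_of_expansion_five hn hK hρ hκ hKv (hf v) (hf' v)
    rw [abs_of_pos hv0] at h1
    refine (le_of_eq ?_).trans (h1.trans ((le_of_eq ?_).trans (add_le_add (a := (5 * K ^ 2 * u ^ 5 +
      K ^ 3 * u ^ 9 + K ^ 2 * u ^ 7) / N ^ 3 * Real.exp (-(u ^ 2 / 8))) (c := 0) ?_ hrest)))
    · have hI : (Complex.I) ^ 4 = 1 := Complex.I_pow_four
      rw [hNc, hNn, huv]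
      congr 3
      · push_cast
        ring_nf
      · push_cast
        rw [mul_pow _ Complex.I 4, hI]
        congr 1
        · congr 1
          · congr 1
            field_simp
          · field_simp
        · field_simp
    · rw [hNn, huv, add_zero]
      congr 1
      · field_simp
      · congr 1
        ring
    · have h4 := hP 4 (by norm_num)
      have h6 := hP 6 (by norm_num)
      have h8 := hP 8 (by norm_num)
      have hK3 : K ^ 3 ≤ K ^ 5 := pow_le_pow_right₀ hK (by norm_num)
      have hK23 : K ^ 2 ≤ K ^ 5 := pow_le_pow_right₀ hK (by norm_num)
      have k1 : K ^ 2 * u ^ 5 ≤ K ^ 5 * P := by gcongr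
      have k2 : K ^ 3 * u ^ 9 ≤ K ^ 5 * P := by gcongr
      have k3 : K ^ 2 * u ^ 7 ≤ K ^ 5 * P := by gcongr
      have h9 : 0 ≤ K ^ 5 * P := by positivity
      gcongr
      linarith
  · have hKu : 1 ≤ 8 * K * v := by
      rwa [inv_le_iff_one_le_mul₀ (by positivity), mul_comm] at h
    have hKu' : 1 ≤ 8 * K * u := hKu.trans (by
      rw [huv]
      have := le_mul_of_one_le_left hv0.le hN1
      gcongr)
    have h1 : ‖f v ^ n‖ ≤ 8 * K * u * c ^ n := by
      rw [norm_pow]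
      have h2 := hc v h
      exact (pow_le_pow_left₀ (norm_nonneg _) h2 n).trans
        (le_mul_of_one_le_left (by positivity) hKu')
    have h3 : ‖Complex.exp (-(u ^ 2 / 2))‖ ≤ Real.exp (-(u ^ 2 / 8)) := by
      rw [Complex.norm_exp, Real.exp_le_exp, ← Complex.ofReal_pow]
      norm_num [← Complex.ofReal_pow]
      nlinarith [sq_nonneg u]
    have hKK : K ≤ K ^ 2 := le_self_pow₀ hK (by norm_num)
    have hb : ∀ {r s C : ℝ}, |r| ≤ C → 1 ≤ s → |r / s| ≤ C := by
      intro r s C hr hs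
      rw [abs_div, abs_of_pos (by linarith : 0 < s)]
      exact (div_le_self (abs_nonneg _) hs).trans hr
    have h4 : ‖(1 : ℂ) + (ρ / (6 * N) : ℝ) * (u * Complex.I) ^ 3 +
        (κ / (24 * n) : ℝ) * (u * Complex.I) ^ 4 +
        (ρ ^ 2 / (72 * n) : ℝ) * (u * Complex.I) ^ 6‖ ≤
        K ^ 2 * 1 + K ^ 2 * u ^ 3 + K ^ 2 * u ^ 4 + K ^ 2 * u ^ 6 := by
      refine (norm_add_le _ _).trans (add_le_add ((norm_add_le _ _).trans
        (add_le_add ((norm_add_le _ _).trans (add_le_add ?_ ?_)) ?_)) ?_)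
      · rw [norm_one]
        nlinarith
      all_goals
        simp only [norm_mul, norm_pow, Complex.norm_real, Complex.norm_I, mul_one,
          Real.norm_eq_abs, abs_of_pos hu]
        refine mul_le_mul_of_nonneg_right ?_ (by positivity)
      · exact hb (hρ.trans hKK) (by linarith)
      · exact hb (hκ.trans hKK) (by linarith)
      · refine hb ?_ (by linarith)
        rw [abs_pow]
        gcongr
    have h5 : K ^ 2 * 1 + K ^ 2 * u ^ 3 + K ^ 2 * u ^ 4 + K ^ 2 * u ^ 6 ≤
        2048 * K ^ 5 * P / N ^ 3 := by
      have h6 : K ^ 2 * 1 + K ^ 2 * u ^ 3 + K ^ 2 * u ^ 4 + K ^ 2 * u ^ 6 ≤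
          (K ^ 2 * 1 + K ^ 2 * u ^ 3 + K ^ 2 * u ^ 4 + K ^ 2 * u ^ 6) * (8 * K * v) ^ 3 :=
        le_mul_of_one_le_right (by positivity) (one_le_pow₀ hKu)
      refine h6.trans ?_
      have e : (K ^ 2 * 1 + K ^ 2 * u ^ 3 + K ^ 2 * u ^ 4 + K ^ 2 * u ^ 6) * (8 * K * v) ^ 3 =
          512 * K ^ 5 * (u ^ 3 + u ^ 6 + u ^ 7 + u ^ 9) / N ^ 3 := by
        rw [hv]; field_simp; ring
      rw [e]
      have h7 := hP 2 (by norm_num)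
      have h8 := hP 5 (by norm_num)
      have h9 := hP 6 (by norm_num)
      have h10 := hP 8 (by norm_num)
      have h11 : 512 * K ^ 5 * (u ^ 3 + u ^ 6 + u ^ 7 + u ^ 9) ≤
          512 * K ^ 5 * (P + P + P + P) := by gcongr
      exact div_le_div_of_nonneg_right (h11.trans (by linarith)) (by positivity)
    refine (norm_sub_le _ _).trans ((add_comm _ _).le.trans (add_le_add ?_ h1))
    rw [norm_mul, mul_comm]
    exact mul_le_mul (h4.trans h5) h3 (norm_nonneg _) (by positivity)

/-! ### Characteristic functions away from the origin -/

lemma integrable_cexp_mul_I (F : Measure ℝ) [IsProbabilityMeasure F] (v : ℝ) :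
    Integrable (fun x : ℝ => Complex.exp (v * x * Complex.I)) F := by
  refine (integrable_const (1 : ℝ)).mono' (by fun_prop) (ae_of_all _ fun x => ?_)
  rw [← Complex.ofReal_mul, Complex.norm_exp_ofReal_mul_I]

lemma re_cexp_mul_charFun (F : Measure ℝ) [IsProbabilityMeasure F] (v α : ℝ) :
    (Complex.exp ((-α : ℝ) * Complex.I) * charFun F v).re = ∫ x, Real.cos (v * x - α) ∂F := by
  have h := integral_re ((integrable_cexp_mul_I F v).const_mul
    (Complex.exp ((-α : ℝ) * Complex.I)))
  simp only [RCLike.re_to_complex] at h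
  rw [charFun_apply_real, ← integral_const_mul, ← h]
  refine integral_congr_ae (ae_of_all _ fun x => ?_)
  simp only
  rw [← Complex.exp_add, ← add_mul, ← Complex.ofReal_mul, ← Complex.ofReal_add,
    Complex.exp_ofReal_mul_I_re]
  congr 1
  ring

/-- If the modulus of a characteristic function is close to `1` at `v`, it is close to `1` at
`2 * v`: apply `1 - cos (2 * y) ≤ 4 * (1 - cos y)` to the rotated variable. -/
lemma one_sub_norm_charFun_two_mul_le (F : Measure ℝ) [IsProbabilityMeasure F] (v : ℝ) :
    1 - ‖charFun F (2 * v)‖ ≤ 4 * (1 - ‖charFun F v‖) := by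
  set α := (charFun F v).arg with hα
  have hint : ∀ w β : ℝ, Integrable (fun x => Real.cos (w * x - β)) F := fun w β =>
    (integrable_const (1 : ℝ)).mono' (by fun_prop) (ae_of_all _ fun x => Real.abs_cos_le_one _)
  have h1 : ‖charFun F v‖ = ∫ x, Real.cos (v * x - α) ∂F := by
    rw [← re_cexp_mul_charFun]
    nth_rewrite 2 [← Complex.norm_mul_exp_arg_mul_I (charFun F v)]
    rw [mul_left_comm, ← Complex.exp_add, ← hα]
    simp
  have h2 : ∫ x, Real.cos (2 * v * x - 2 * α) ∂F ≤ ‖charFun F (2 * v)‖ := by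
    rw [← re_cexp_mul_charFun]
    refine (Complex.re_le_norm _).trans ?_
    rw [norm_mul, Complex.norm_exp_ofReal_mul_I, one_mul]
  have h3 : 1 - ∫ x, Real.cos (2 * v * x - 2 * α) ∂F ≤ 4 * (1 - ∫ x, Real.cos (v * x - α) ∂F) := by
    have e : (1 : ℝ) = ∫ _, (1 : ℝ) ∂F := by simp
    rw [e, ← integral_sub (integrable_const _) (hint _ _),
      ← integral_sub (integrable_const _) (hint _ _), ← integral_const_mul]
    refine integral_mono ((integrable_const _).sub (hint _ _))
      (((integrable_const _).sub (hint _ _)).const_mul 4) fun x => ?_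
    simp only
    rw [show 2 * v * x - 2 * α = 2 * (v * x - α) by ring, Real.cos_two_mul]
    nlinarith [sq_nonneg (Real.cos (v * x - α) - 1)]
  linarith

lemma one_sub_norm_charFun_two_pow_mul_le (F : Measure ℝ) [IsProbabilityMeasure F] (v : ℝ)
    (k : ℕ) : 1 - ‖charFun F (2 ^ k * v)‖ ≤ 4 ^ k * (1 - ‖charFun F v‖) := by
  induction k with
  | zero => simp
  | succ k ih =>
    have h := one_sub_norm_charFun_two_mul_le F (2 ^ k * v)
    rw [← mul_assoc, ← pow_succ'] at h
    rw [pow_succ' 4]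
    linarith

lemma norm_charFun_le_of_two_pow {F : Measure ℝ} [IsProbabilityMeasure F] {v c : ℝ} {k : ℕ}
    (h : ‖charFun F (2 ^ k * v)‖ ≤ c) : ‖charFun F v‖ ≤ 1 - (1 - c) / 4 ^ k := by
  have h1 := one_sub_norm_charFun_two_pow_mul_le F v k
  have h2 : (1 - c) / 4 ^ k ≤ 1 - ‖charFun F v‖ := by
    rw [div_le_iff₀ (by positivity)]
    linarith
  linarith

lemma exists_two_pow_mul_gt {δ : ℝ} (hδ : 0 < δ) (U : ℝ) : ∃ k : ℕ, U < 2 ^ k * δ := by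
  obtain ⟨k, hk⟩ := pow_unbounded_of_one_lt (U / δ) (by norm_num : (1 : ℝ) < 2)
  exact ⟨k, by rwa [div_lt_iff₀ hδ] at hk⟩

lemma one_sub_div_four_pow_mem {c : ℝ} (h0 : 0 ≤ c) (h1 : c < 1) (k : ℕ) :
    0 ≤ 1 - (1 - c) / 4 ^ k ∧ 1 - (1 - c) / 4 ^ k < 1 := by
  have h2 : 0 < (1 - c) / 4 ^ k := div_pos (by linarith) (by positivity)
  have h3 : (1 - c) / 4 ^ k ≤ 1 - c := div_le_self (by linarith) (one_le_pow₀ (by norm_num))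
  constructor <;> linarith

section Uniform

variable {ι : Type*} {F : ι → Measure ℝ} [∀ t, IsProbabilityMeasure (F t)]

lemma norm_charFun_le_iSup (v : ℝ) (t : ι) : ‖charFun (F t) v‖ ≤ ⨆ t, ‖charFun (F t) v‖ :=
  le_ciSup (f := fun t => ‖charFun (F t) v‖)
    ⟨1, by rintro _ ⟨t, rfl⟩; exact norm_charFun_le_one v⟩ t

lemma iSup_norm_charFun_mem (v : ℝ) :
    0 ≤ ⨆ t, ‖charFun (F t) v‖ ∧ ⨆ t, ‖charFun (F t) v‖ ≤ 1 :=
  ⟨Real.iSup_nonneg fun _ => norm_nonneg _,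
    Real.iSup_le (fun _ => norm_charFun_le_one v) zero_le_one⟩

/-- The uniform non-lattice condition extends to every compact subset of `(0, ∞)`. -/
lemma UniformNoLattice.exists_norm_charFun_le (h : UniformNoLattice F) {δ : ℝ} (hδ : 0 < δ)
    (A : ℝ) : ∃ c, 0 ≤ c ∧ c < 1 ∧ ∀ t v, δ ≤ v → v ≤ A → ‖charFun (F t) v‖ ≤ c := by
  obtain ⟨u₀, -, h⟩ := h
  obtain ⟨k, hk⟩ := exists_two_pow_mul_gt hδ u₀
  have hc := h (2 ^ k * A + 1)
  set c := ⨆ u : Set.Ioo u₀ (2 ^ k * A + 1), ⨆ t, ‖charFun (F t) (u : ℝ)‖ with hcdef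
  have hc0 : 0 ≤ c := Real.iSup_nonneg fun u => (iSup_norm_charFun_mem (F := F) (u : ℝ)).1
  obtain ⟨h0, h1⟩ := one_sub_div_four_pow_mem hc0 hc k
  refine ⟨_, h0, h1, fun t v hv hvA => norm_charFun_le_of_two_pow ?_⟩
  have hm : 2 ^ k * v ∈ Set.Ioo u₀ (2 ^ k * A + 1) := by
    constructor
    · exact hk.trans_le (by gcongr)
    · have : (2 : ℝ) ^ k * v ≤ 2 ^ k * A := by gcongr
      linarith
  refine (norm_charFun_le_iSup (2 ^ k * v) t).trans ?_
  exact le_ciSup (f := fun u : Set.Ioo u₀ (2 ^ k * A + 1) => ⨆ t, ‖charFun (F t) (u : ℝ)‖)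
    ⟨1, by rintro _ ⟨u, rfl⟩; exact (iSup_norm_charFun_mem (F := F) (u : ℝ)).2⟩ ⟨_, hm⟩

/-- The uniform Cramér condition extends to every half-line `[δ, ∞)` with `δ > 0`. -/
lemma UniformCramer.exists_norm_charFun_le (h : UniformCramer F) {δ : ℝ} (hδ : 0 < δ) :
    ∃ c, 0 ≤ c ∧ c < 1 ∧ ∀ t v, δ ≤ v → ‖charFun (F t) v‖ ≤ c := by
  obtain ⟨c, hc, hc1⟩ := exists_between h
  have hev := eventually_lt_of_limsup_lt hc
    (isBoundedUnder_of ⟨1, fun u => (iSup_norm_charFun_mem (F := F) u).2⟩)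
  obtain ⟨U, hU⟩ := eventually_atTop.1 hev
  obtain ⟨k, hk⟩ := exists_two_pow_mul_gt hδ U
  have hc0 : 0 ≤ c := (iSup_norm_charFun_mem (F := F) U).1.trans (hU U le_rfl).le
  obtain ⟨h0, h1⟩ := one_sub_div_four_pow_mem hc0 hc1 k
  refine ⟨_, h0, h1, fun t v hv => norm_charFun_le_of_two_pow ?_⟩
  have hm : U ≤ 2 ^ k * v := hk.le.trans (by gcongr)
  exact (norm_charFun_le_iSup (2 ^ k * v) t).trans (hU _ hm).le

end Uniform

/-! ### Distribution functions of normalized sums -/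

lemma edgeworthH_eq_setIntegral (ρ : ℝ) (n : ℕ) (s : ℝ) :
    edgeworthH ρ n s = ∫ x in Set.Iio s, edgeworthDensity (ρ / (6 * √n)) 0 0 x := by
  rw [setIntegral_Iio_edgeworthDensity, edgeworthH]
  ring

lemma edgeworthG_eq_setIntegral (ρ κ : ℝ) (n : ℕ) (s : ℝ) :
    edgeworthG ρ κ n s = ∫ x in Set.Iio s,
      edgeworthDensity (ρ / (6 * √n)) (κ / (24 * n)) (ρ ^ 2 / (72 * n)) x := by
  rw [setIntegral_Iio_edgeworthDensity, edgeworthG, edgeworthH]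
  ring

lemma exists_abs_setIntegral_edgeworthDensity_le : ∃ C : ℝ, 0 < C ∧ ∀ a b c s,
    |∫ x in Set.Iio s, edgeworthDensity a b c x| ≤ C * (1 + |a| + |b| + |c|) := by
  obtain ⟨C2, h2, k2⟩ := exists_abs_hermiteGaussian_le 2
  obtain ⟨C3, h3, k3⟩ := exists_abs_hermiteGaussian_le 3
  obtain ⟨C5, h5, k5⟩ := exists_abs_hermiteGaussian_le 5
  refine ⟨1 + C2 + C3 + C5, by positivity, fun a b c s => ?_⟩
  have e : ∫ x in Set.Iio s, edgeworthDensity a b c x = cdf (gaussianReal 0 1) s -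
      (a * hermiteGaussian 2 s + b * hermiteGaussian 3 s + c * hermiteGaussian 5 s) := by
    rw [setIntegral_Iio_edgeworthDensity, hermiteGaussian_two, hermiteGaussian_three,
      hermiteGaussian_five]
    ring
  have t0 := cdf_nonneg (gaussianReal 0 1) s
  have t1 := cdf_le_one (gaussianReal 0 1) s
  have t : ∀ {r C y : ℝ}, |y| ≤ C → -(|r| * C) ≤ r * y ∧ r * y ≤ |r| * C := fun {r C y} hy =>
    abs_le.1 ((abs_mul r y).le.trans (mul_le_mul_of_nonneg_left hy (abs_nonneg r)))
  have t2 := t (r := a) (k2 s)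
  have t3 := t (r := b) (k3 s)
  have t5 := t (r := c) (k5 s)
  have h : |∫ x in Set.Iio s, edgeworthDensity a b c x| ≤ 1 + |a| * C2 + |b| * C3 + |c| * C5 := by
    rw [e, abs_le]
    constructor <;> linarith [t2.1, t2.2, t3.1, t3.2, t5.1, t5.2]
  refine h.trans ?_
  have : 0 ≤ |a| * (1 + C3 + C5) + |b| * (1 + C2 + C5) + |c| * (1 + C2 + C3) + C2 + C3 + C5 := by
    positivity
  linarith

section Sum

variable {Ω : Type*} [MeasurableSpace Ω] {P : Measure Ω} {X : ℕ → Ω → ℝ}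
  {F : Measure ℝ}

/-- The law of the normalized sum `(X 0 + ⋯ + X (n - 1)) / √n`. -/
noncomputable def normalizedSumLaw (P : Measure Ω) (X : ℕ → Ω → ℝ) (n : ℕ) : Measure ℝ :=
  P.map fun ω => (√n)⁻¹ * ∑ k ∈ Finset.range n, X k ω

lemma aemeasurable_normalizedSum (hlaw : ∀ i, HasLaw (X i) F P) (n : ℕ) :
    AEMeasurable (fun ω => (√n)⁻¹ * ∑ k ∈ Finset.range n, X k ω) P :=
  .const_mul (Finset.aemeasurable_fun_sum _ fun i _ => (hlaw i).aemeasurable) _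

lemma isProbabilityMeasure_normalizedSumLaw [IsProbabilityMeasure P]
    (hlaw : ∀ i, HasLaw (X i) F P) (n : ℕ) :
    IsProbabilityMeasure (normalizedSumLaw P X n) :=
  Measure.isProbabilityMeasure_map (aemeasurable_normalizedSum hlaw n)

lemma normalizedSumDist_eq (hlaw : ∀ i, HasLaw (X i) F P) {n : ℕ} (hn : 0 < n) (s : ℝ) :
    normalizedSumDist P X n s = (normalizedSumLaw P X n).real (Set.Iio s) := by
  have hN : 0 < √(n : ℝ) := Real.sqrt_pos.2 (by exact_mod_cast hn)
  rw [normalizedSumDist, normalizedSumLaw, measureReal_def, measureReal_def,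
    Measure.map_apply_of_aemeasurable (aemeasurable_normalizedSum hlaw n) measurableSet_Iio]
  congr 2
  ext ω
  simp only [Set.mem_ofPred_eq, Set.mem_preimage, Set.mem_Iio]
  rw [inv_mul_lt_iff₀ hN, mul_comm s]

lemma charFun_normalizedSumLaw (hindep : iIndepFun X P) (hlaw : ∀ i, HasLaw (X i) F P) (n : ℕ)
    (u : ℝ) : charFun (normalizedSumLaw P X n) u = charFun F ((√n)⁻¹ * u) ^ n := by
  have hid : ∀ i, IdentDistrib (X i) (X 0) P P := fun i =>
    ⟨(hlaw i).aemeasurable, (hlaw 0).aemeasurable, by rw [(hlaw i).map_eq, (hlaw 0).map_eq]⟩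
  rw [normalizedSumLaw, charFun_inv_sqrt_mul_sum hindep hid, (hlaw 0).map_eq]

lemma integrable_normalizedSumLaw (hlaw : ∀ i, HasLaw (X i) F P)
    (hX : ∀ i, Integrable (X i) P) (n : ℕ) :
    Integrable (fun x : ℝ => x) (normalizedSumLaw P X n) := by
  rw [normalizedSumLaw, integrable_map_measure (by fun_prop) (aemeasurable_normalizedSum hlaw n)]
  exact (integrable_finsetSum _ fun i _ => hX i).const_mul _

end Sum

lemma abs_integral_pow_three_le (F : Measure ℝ) [IsProbabilityMeasure F]
    (hF : Integrable (fun x : ℝ => x ^ 4) F) :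
    |∫ x, x ^ 3 ∂F| ≤ 1 + ∫ x, x ^ 4 ∂F := by
  have e : 1 + ∫ x, x ^ 4 ∂F = ∫ x, (1 + x ^ 4) ∂F := by
    rw [integral_add (integrable_const _) hF]
    simp
  rw [e, ← Real.norm_eq_abs]
  refine norm_integral_le_of_norm_le ((integrable_const _).add hF) (ae_of_all _ fun x => ?_)
  rw [Real.norm_eq_abs, abs_le]
  constructor <;> nlinarith [sq_nonneg (x ^ 2 - 1), sq_nonneg (x ^ 2 - x), sq_nonneg (x ^ 2 + x),
    sq_nonneg x]

lemma integral_pow_four_le (F : Measure ℝ) [IsProbabilityMeasure F]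
    (hF : Integrable (fun x : ℝ => x ^ 4) F) (hF' : Integrable (fun x : ℝ => |x| ^ 5) F) :
    ∫ x, x ^ 4 ∂F ≤ 1 + ∫ x, |x| ^ 5 ∂F := by
  have e : 1 + ∫ x, |x| ^ 5 ∂F = ∫ x, (1 + |x| ^ 5) ∂F := by
    rw [integral_add (integrable_const _) hF']
    simp
  rw [e]
  refine integral_mono hF ((integrable_const _).add hF') fun x => ?_
  simp only
  rw [← Even.pow_abs (by decide : Even 4) x]
  rcases le_total |x| 1 with h | h
  · exact (pow_le_one₀ (abs_nonneg x) h).trans (le_add_of_nonneg_right (by positivity))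
  · exact (pow_le_pow_right₀ h (by norm_num)).trans (le_add_of_nonneg_left zero_le_one)

/-- The hypotheses on the common law `F` of the summands that enter the estimates: standardized,
with finite fourth moment, skewness `ρ` and excess kurtosis `κ`. -/
structure IsStandardizedLaw (F : Measure ℝ) (ρ κ : ℝ) : Prop where
  integrable_pow_four : Integrable (fun x : ℝ => x ^ 4) F
  mean : ∫ x, x ∂F = 0
  variance : ∫ x, x ^ 2 ∂F = 1
  skewness : ∫ x, x ^ 3 ∂F = ρ
  kurtosis : ∫ x, x ^ 4 ∂F = κ + 3

lemma isStandardizedLaw_of_hasLaw {Ω : Type*} [MeasurableSpace Ω] {P : Measure Ω}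
    [IsProbabilityMeasure P] {X : Ω → ℝ} {F : Measure ℝ} {ρ κ : ℝ} (hlaw : HasLaw X F P)
    (hL4 : MemLp X 4 P) (hmean : ∫ ω, X ω ∂P = 0) (hvar : ∫ ω, X ω ^ 2 ∂P = 1)
    (hρ : ∫ ω, X ω ^ 3 ∂P = ρ) (hκ : ∫ ω, X ω ^ 4 ∂P - 3 = κ) : IsStandardizedLaw F ρ κ := by
  have hm : ∀ k : ℕ, ∫ x, x ^ k ∂F = ∫ ω, X ω ^ k ∂P := fun k =>
    (hlaw.integral_comp (f := fun x : ℝ => x ^ k) (by fun_prop)).symm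
  refine ⟨?_, ?_, (hm 2).trans hvar, (hm 3).trans hρ, (hm 4).trans (by linarith)⟩
  · have h := hL4.integrable_norm_pow (p := 4) (by norm_num)
    rw [← hlaw.map_eq, integrable_map_measure (by fun_prop) hlaw.aemeasurable]
    refine h.congr (ae_of_all _ fun ω => ?_)
    simp [Even.pow_abs (by decide : Even 4)]
  · have := hm 1
    simp only [pow_one] at this
    rw [this, hmean]

/-! ### The uniform expansions -/

/-- First-order bound, with explicit dependence on the frequency range `A * √n` and on the bound `c`
of the characteristic function there. -/
lemma exists_abs_sub_edgeworthH_le {K : ℝ} (hK : 1 ≤ K) : ∃ C : ℝ, 0 < C ∧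
    ∀ (μ F : Measure ℝ) [IsProbabilityMeasure μ] [IsProbabilityMeasure F] (ρ κ A c : ℝ) (n : ℕ)
    (_ : Integrable (fun x : ℝ => x) μ) (_ : ∀ u, charFun μ u = charFun F ((√n)⁻¹ * u) ^ n)
    (_ : IsStandardizedLaw F ρ κ) (_ : 7 * ∫ x, x ^ 4 ∂F ≤ K) (_ : |ρ| ≤ K) (_ : 0 < A) (_ : 0 ≤ c)
    (_ : ∀ v, (8 * K)⁻¹ ≤ v → v ≤ A → ‖charFun F v‖ ≤ c) (_ : 2 ≤ n) (s : ℝ),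
    |μ.real (Set.Iio s) - edgeworthH ρ n s| ≤
      C * (1 / √n ^ 2 + A * √n * c ^ n + 1 / (A * √n)) := by
  obtain ⟨C, hC, h⟩ := exists_abs_sub_edgeworth_le
  refine ⟨C * (128 * K ^ 3 + 8 * K + (1 + K)), by positivity, ?_⟩
  intro μ F _ _ ρ κ A c n hμ hch hF hF4 hρ hA hc0 hc hn s
  have hn1 : (1 : ℝ) ≤ n := by exact_mod_cast (by omega : 1 ≤ n)
  set N := √(n : ℝ) with hN
  have hN1 : 1 ≤ N := Real.one_le_sqrt.2 hn1
  have hf : ∀ v : ℝ, ‖charFun F v - (1 - v ^ 2 / 2 + ρ / 6 * (v * Complex.I) ^ 3)‖ ≤ K * v ^ 4 :=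
    fun v => (norm_charFun_sub_le_four F hF.integrable_pow_four hF.mean hF.variance
      hF.skewness v).trans (mul_le_mul_of_nonneg_right hF4 (Even.pow_nonneg (by decide) v))
  have h1 := h μ hμ (ρ / (6 * N)) 0 0 (128 * K ^ 3 / N ^ 2) (8 * K * c ^ n) (A * N)
    (by positivity) (by positivity) (by positivity) (by
      intro u hu huT
      have h2 := norm_pow_sub_le_first_order hK hρ hf hc0 hc hn hu huT
      rw [← hN, ← hch] at h2
      simpa using h2) s
  rw [edgeworthH_eq_setIntegral]
  refine h1.trans ?_
  rw [mul_assoc C]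
  refine mul_le_mul_of_nonneg_left ?_ hC.le
  have h3 : |ρ / (6 * N)| ≤ K := by
    rw [abs_div, abs_of_pos (by positivity : 0 < 6 * N)]
    exact (div_le_self (abs_nonneg _) (by linarith)).trans hρ
  have h4 : (1 + |ρ / (6 * N)| + |(0 : ℝ)| + |(0 : ℝ)|) / (A * N) ≤ (1 + K) * (1 / (A * N)) := by
    rw [mul_one_div]
    simp only [abs_zero, add_zero]
    gcongr
  have e1 : 128 * K ^ 3 / N ^ 2 = 128 * K ^ 3 * (1 / N ^ 2) := by ring
  have e2 : 8 * K * c ^ n * (A * N) = 8 * K * (A * N * c ^ n) := by ring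
  rw [e1, e2]
  have p1 : 0 ≤ 1 / N ^ 2 := by positivity
  have p2 : 0 ≤ A * N * c ^ n := by positivity
  have p3 : 0 ≤ 1 / (A * N) := by positivity
  have q1 : 0 ≤ (8 * K + (1 + K)) * (1 / N ^ 2) + (128 * K ^ 3 + (1 + K)) * (A * N * c ^ n) +
    (128 * K ^ 3 + 8 * K) * (1 / (A * N)) := by positivity
  linarith

/-- Second-order bound, obtained by smoothing at the scale `(√n) ^ 3`. -/
lemma exists_abs_sub_edgeworthG_le {K : ℝ} (hK : 1 ≤ K) : ∃ C : ℝ, 0 < C ∧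
    ∀ (μ F : Measure ℝ) [IsProbabilityMeasure μ] [IsProbabilityMeasure F] (ρ κ c : ℝ) (n : ℕ)
    (_ : Integrable (fun x : ℝ => x) μ) (_ : ∀ u, charFun μ u = charFun F ((√n)⁻¹ * u) ^ n)
    (_ : IsStandardizedLaw F ρ κ) (_ : Integrable (fun x : ℝ => |x| ^ 5) F)
    (_ : 7 * ∫ x, x ^ 4 ∂F ≤ K) (_ : 8 * ∫ x, |x| ^ 5 ∂F ≤ K) (_ : |ρ| ≤ K) (_ : |κ| ≤ K)
    (_ : 0 ≤ c) (_ : ∀ v, (8 * K)⁻¹ ≤ v → ‖charFun F v‖ ≤ c) (_ : 2 ≤ n) (s : ℝ),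
    |μ.real (Set.Iio s) - edgeworthG ρ κ n s| ≤ C * (1 / √n ^ 3 + √n ^ 3 * c ^ n) := by
  obtain ⟨C, hC, h⟩ := exists_abs_sub_edgeworth_le
  refine ⟨C * (2048 * K ^ 5 + 8 * K + (1 + 3 * K ^ 2)), by positivity, ?_⟩
  intro μ F _ _ ρ κ c n hμ hch hF hi5 hF4 hF5 hρ hκ hc0 hc hn s
  have hn1 : (1 : ℝ) ≤ n := by exact_mod_cast (by omega : 1 ≤ n)
  set N := √(n : ℝ) with hN
  have hN1 : 1 ≤ N := Real.one_le_sqrt.2 hn1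
  have hf : ∀ v : ℝ, ‖charFun F v - (1 - v ^ 2 / 2 + ρ / 6 * (v * Complex.I) ^ 3)‖ ≤ K * v ^ 4 :=
    fun v => (norm_charFun_sub_le_four F hF.integrable_pow_four hF.mean hF.variance
      hF.skewness v).trans (mul_le_mul_of_nonneg_right hF4 (Even.pow_nonneg (by decide) v))
  have hf' : ∀ v : ℝ, ‖charFun F v - (1 - v ^ 2 / 2 + ρ / 6 * (v * Complex.I) ^ 3 +
      (κ + 3) / 24 * v ^ 4)‖ ≤ K * |v| ^ 5 :=
    fun v => (norm_charFun_sub_le_five F hi5 hF.mean hF.variance hF.skewness hF.kurtosis v).trans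
      (mul_le_mul_of_nonneg_right hF5 (by positivity))
  have h1 := h μ hμ (ρ / (6 * N)) (κ / (24 * n)) (ρ ^ 2 / (72 * n)) (2048 * K ^ 5 / N ^ 3)
    (8 * K * c ^ n) (N ^ 3) (by positivity) (by positivity) (by positivity) (by
      intro u hu _
      have h2 := norm_pow_sub_le_second_order hK hρ hκ hf hf' hc0 hc hn hu
      rwa [← hN, ← hch] at h2) s
  rw [edgeworthG_eq_setIntegral]
  refine h1.trans ?_
  rw [mul_assoc C]
  refine mul_le_mul_of_nonneg_left ?_ hC.le
  have hKK : K ≤ K ^ 2 := le_self_pow₀ hK (by norm_num)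
  have hb : ∀ {r s D : ℝ}, |r| ≤ D → 1 ≤ s → |r / s| ≤ D := by
    intro r s D hr hs
    rw [abs_div, abs_of_pos (by linarith : 0 < s)]
    exact (div_le_self (abs_nonneg _) hs).trans hr
  have h3 : |ρ / (6 * N)| ≤ K ^ 2 := hb (hρ.trans hKK) (by linarith)
  have h4 : |κ / (24 * n)| ≤ K ^ 2 := hb (hκ.trans hKK) (by linarith)
  have h5 : |ρ ^ 2 / (72 * n)| ≤ K ^ 2 := hb (by rw [abs_pow]; gcongr) (by linarith)
  have h6 : (1 + |ρ / (6 * N)| + |κ / (24 * n)| + |ρ ^ 2 / (72 * n)|) / N ^ 3 ≤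
      (1 + 3 * K ^ 2) * (1 / N ^ 3) := by
    rw [mul_one_div]
    exact div_le_div_of_nonneg_right (by linarith) (by positivity)
  have e1 : 2048 * K ^ 5 / N ^ 3 = 2048 * K ^ 5 * (1 / N ^ 3) := by ring
  have e2 : 8 * K * c ^ n * N ^ 3 = 8 * K * (N ^ 3 * c ^ n) := by ring
  rw [e1, e2]
  have q1 : 0 ≤ 8 * K * (1 / N ^ 3) + (2048 * K ^ 5 + (1 + 3 * K ^ 2)) * (N ^ 3 * c ^ n) := by
    positivity
  linarith

lemma bddAbove_range_abs_sub_edgeworthDensity {ι : Type*} {p a b c : ι → ℝ} {s : ι → ℝ} {K : ℝ}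
    (hp : ∀ i, |p i| ≤ 1) (ha : ∀ i, |a i| ≤ K) (hb : ∀ i, |b i| ≤ K) (hc : ∀ i, |c i| ≤ K) :
    BddAbove (Set.range fun i =>
      |p i - ∫ x in Set.Iio (s i), edgeworthDensity (a i) (b i) (c i) x|) := by
  obtain ⟨C, hC, h⟩ := exists_abs_setIntegral_edgeworthDensity_le
  refine ⟨1 + C * (1 + K + K + K), ?_⟩
  rintro _ ⟨i, rfl⟩
  refine (abs_sub _ _).trans (add_le_add (hp i) ((h _ _ _ _).trans ?_))
  have := ha i
  have := hb i
  have := hc i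
  gcongr

lemma abs_normalizedSumDist_le_one {Ω : Type*} [MeasurableSpace Ω] (P : Measure Ω)
    [IsProbabilityMeasure P] (X : ℕ → Ω → ℝ) (n : ℕ) (s : ℝ) :
    |normalizedSumDist P X n s| ≤ 1 := by
  rw [normalizedSumDist, abs_of_nonneg measureReal_nonneg]
  exact measureReal_le_one

theorem mainTheorem2 (Θ : Set ℝ) {Ω : Θ → Type*} [∀ t, MeasurableSpace (Ω t)]
    (P : ∀ t, Measure (Ω t)) [∀ t, IsProbabilityMeasure (P t)]
    (ξ : ∀ t, ℕ → Ω t → ℝ) (F : Θ → Measure ℝ) (ρ κ : Θ → ℝ)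
    (hindep : ∀ t, iIndepFun (ξ t) (P t))
    (hlaw : ∀ t i, HasLaw (ξ t i) (F t) (P t))
    (hL4 : ∀ t i, MemLp (ξ t i) 4 (P t))
    (hmean : ∀ t i, ∫ ω, ξ t i ω ∂(P t) = 0)
    (hvar : ∀ t i, ∫ ω, ξ t i ω ^ 2 ∂(P t) = 1)
    (hρ : ∀ t i, ∫ ω, ξ t i ω ^ 3 ∂(P t) = ρ t)
    (hκ : ∀ t i, ∫ ω, ξ t i ω ^ 4 ∂(P t) - 3 = κ t) :
    -- Part (a)
    (BddAbove (Set.range κ) → UniformNoLattice F →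
      (∀ n : ℕ, 0 < n → BddAbove (Set.range fun p : ℝ × Θ =>
        |normalizedSumDist (P p.2) (ξ p.2) n p.1 - edgeworthH (ρ p.2) n p.1|)) ∧
      (fun n : ℕ => ⨆ p : ℝ × Θ,
        |normalizedSumDist (P p.2) (ξ p.2) n p.1 - edgeworthH (ρ p.2) n p.1|)
        =o[atTop] fun n : ℕ => (n : ℝ) ^ (-(1 / 2) : ℝ)) ∧
    -- Part (b)
    ((⨆ t, ∫⁻ ω, ‖ξ t 0 ω‖ₑ ^ 5 ∂(P t)) < ⊤ → UniformCramer F →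
      (∀ n : ℕ, 0 < n → BddAbove (Set.range fun p : ℝ × Θ =>
        |normalizedSumDist (P p.2) (ξ p.2) n p.1 - edgeworthG (ρ p.2) (κ p.2) n p.1|)) ∧
      (fun n : ℕ => ⨆ p : ℝ × Θ,
        |normalizedSumDist (P p.2) (ξ p.2) n p.1 - edgeworthG (ρ p.2) (κ p.2) n p.1|)
        =O[atTop] fun n : ℕ => (n : ℝ) ^ (-(3 / 2) : ℝ))
 := by
  have hprob : ∀ t, IsProbabilityMeasure (F t) := fun t =>
    (hlaw t 0).isProbabilityMeasure_iff.1 inferInstance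
  have hstd : ∀ t, IsStandardizedLaw (F t) (ρ t) (κ t) := fun t =>
    isStandardizedLaw_of_hasLaw (hlaw t 0) (hL4 t 0) (hmean t 0) (hvar t 0) (hρ t 0) (hκ t 0)
  have hμ : ∀ t n, IsProbabilityMeasure (normalizedSumLaw (P t) (ξ t) n) := fun t n =>
    isProbabilityMeasure_normalizedSumLaw (hlaw t) n
  have hint : ∀ t n, Integrable (fun x : ℝ => x) (normalizedSumLaw (P t) (ξ t) n) := fun t n =>
    integrable_normalizedSumLaw (hlaw t) (fun i => (hL4 t i).integrable (by norm_num)) n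
  have hcoef : ∀ {r s D : ℝ}, |r| ≤ D → 1 ≤ s → |r / s| ≤ D := by
    intro r s D hr hs
    rw [abs_div, abs_of_pos (by linarith : 0 < s)]
    exact (div_le_self (abs_nonneg _) hs).trans hr
  have hm4 : ∀ t, 0 ≤ ∫ x, x ^ 4 ∂(F t) := fun t =>
    integral_nonneg fun x => Even.pow_nonneg (by decide) x
  constructor
  · rintro ⟨B, hB⟩ hlat
    -- a bound for the fourth moments yields all constants of the expansion
    have hB' : ∀ t, ∫ x, x ^ 4 ∂(F t) ≤ |B| + 3 := fun t => by
      rw [(hstd t).kurtosis]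
      linarith [hB ⟨t, rfl⟩, le_abs_self B]
    set K := 7 * (|B| + 3) with hKdef
    have hK : 1 ≤ K := by linarith [abs_nonneg B]
    have h4K : ∀ t, 7 * ∫ x, x ^ 4 ∂(F t) ≤ K := fun t => by linarith [hB' t]
    have hρK : ∀ t, |ρ t| ≤ K := fun t => by
      have := abs_integral_pow_three_le (F t) (hstd t).integrable_pow_four
      rw [(hstd t).skewness] at this
      linarith [hB' t, abs_nonneg B]
    constructor
    · intro n hn
      have hn1 : (1 : ℝ) ≤ √n := Real.one_le_sqrt.2 (by exact_mod_cast hn)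
      simp only [edgeworthH_eq_setIntegral]
      exact bddAbove_range_abs_sub_edgeworthDensity (K := K)
        (fun _ => abs_normalizedSumDist_le_one _ _ _ _)
        (fun i => hcoef (hρK i.2) (by linarith)) (fun _ => by simp; linarith)
        (fun _ => by simp; linarith)
    · obtain ⟨C, hC, h⟩ := exists_abs_sub_edgeworthH_le hK
      rw [isLittleO_iff]
      intro ε hε
      -- the smoothing error `C / (A √n)` is at most half of the allowed error
      set A := 2 * C / ε with hA
      have hA0 : 0 < A := by positivity
      obtain ⟨c, hc0, hc1, hc⟩ := hlat.exists_norm_charFun_le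
        (by positivity : 0 < (8 * K)⁻¹) A
      have ht1 : Tendsto (fun n : ℕ => C * (1 / √(n : ℝ) + A * ((n : ℝ) ^ 1 * c ^ n))) atTop
          (nhds (C * (0 + A * 0))) := by
        refine Tendsto.const_mul _ (Tendsto.add ?_ (Tendsto.const_mul _
          (tendsto_pow_const_mul_const_pow_of_lt_one 1 hc0 hc1)))
        simp_rw [one_div]
        exact (Real.tendsto_sqrt_atTop.comp tendsto_natCast_atTop_atTop).inv_tendsto_atTop
      rw [mul_zero, add_zero, mul_zero] at ht1
      filter_upwards [ht1.eventually_le_const (half_pos hε), eventually_ge_atTop 2] with n hn1 hn2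
      have hn0 : (0 : ℝ) < n := by exact_mod_cast (by omega : 0 < n)
      set N := √(n : ℝ) with hN
      have hN0 : 0 < N := Real.sqrt_pos.2 hn0
      have hNn : (n : ℝ) = N ^ 2 := (Real.sq_sqrt hn0.le).symm
      have hpow : (n : ℝ) ^ (-(1 / 2) : ℝ) = 1 / N := by
        rw [Real.rpow_neg hn0.le, ← Real.sqrt_eq_rpow, one_div]
      rw [hpow, Real.norm_of_nonneg (Real.iSup_nonneg fun _ => abs_nonneg _),
        Real.norm_of_nonneg (by positivity)]
      refine Real.iSup_le (fun p => ?_) (by positivity)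
      rw [normalizedSumDist_eq (hlaw p.2) (by omega)]
      refine (h _ (F p.2) _ _ A c n (hint p.2 n) (charFun_normalizedSumLaw (hindep p.2)
        (hlaw p.2) n) (hstd p.2) (h4K p.2) (hρK p.2) hA0 hc0 (hc p.2) hn2 p.1).trans ?_
      have e : C * (1 / N ^ 2 + A * N * c ^ n + 1 / (A * N)) =
          (C * (1 / N + A * ((n : ℝ) ^ 1 * c ^ n)) + C / A) * (1 / N) := by
        rw [hNn]
        field_simp
      have e2 : C / A = ε / 2 := by
        rw [hA]
        field_simp
      rw [e, e2]
      exact mul_le_mul_of_nonneg_right (by linarith) (by positivity)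
  · intro h5 hcr
    set B := (⨆ t, ∫⁻ ω, ‖ξ t 0 ω‖ₑ ^ 5 ∂(P t)).toReal with hBdef
    have hB0 : 0 ≤ B := ENNReal.toReal_nonneg
    have hlin : ∀ t, ∫⁻ x, ‖|x| ^ 5‖ₑ ∂(F t) = ∫⁻ ω, ‖ξ t 0 ω‖ₑ ^ 5 ∂(P t) := fun t => by
      rw [← (hlaw t 0).lintegral_comp (by fun_prop)]
      simp [enorm_pow]
    have hle : ∀ t, ∫⁻ x, ‖|x| ^ 5‖ₑ ∂(F t) ≤ ⨆ t, ∫⁻ ω, ‖ξ t 0 ω‖ₑ ^ 5 ∂(P t) := fun t => by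
      rw [hlin]
      exact le_iSup (fun t => ∫⁻ ω, ‖ξ t 0 ω‖ₑ ^ 5 ∂(P t)) t
    have hi5 : ∀ t, Integrable (fun x : ℝ => |x| ^ 5) (F t) := fun t =>
      ⟨by fun_prop, (hle t).trans_lt h5⟩
    have hB5 : ∀ t, ∫ x, |x| ^ 5 ∂(F t) ≤ B := fun t => by
      have h1 : ∫ x, |x| ^ 5 ∂(F t) = ∫ x, ‖|x| ^ 5‖ ∂(F t) := by simp
      rw [h1, integral_norm_eq_lintegral_enorm (by fun_prop)]
      exact ENNReal.toReal_mono h5.ne (hle t)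
    have hB4 : ∀ t, ∫ x, x ^ 4 ∂(F t) ≤ 1 + B := fun t =>
      (integral_pow_four_le (F t) (hstd t).integrable_pow_four (hi5 t)).trans
        (by linarith [hB5 t])
    set K := 8 * B + 7 with hKdef
    have hK : 1 ≤ K := by linarith
    have h4K : ∀ t, 7 * ∫ x, x ^ 4 ∂(F t) ≤ K := fun t => by linarith [hB4 t]
    have h5K : ∀ t, 8 * ∫ x, |x| ^ 5 ∂(F t) ≤ K := fun t => by linarith [hB5 t]
    have hρK : ∀ t, |ρ t| ≤ K := fun t => by
      have := abs_integral_pow_three_le (F t) (hstd t).integrable_pow_four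
      rw [(hstd t).skewness] at this
      linarith [hB4 t]
    have hκK : ∀ t, |κ t| ≤ K := fun t => by
      have h1 := hB4 t
      have h2 := hm4 t
      rw [(hstd t).kurtosis] at h1 h2
      rw [abs_le]
      constructor <;> linarith
    have hKK : K ≤ K ^ 2 := le_self_pow₀ hK (by norm_num)
    constructor
    · intro n hn
      have hn0 : (1 : ℝ) ≤ n := by exact_mod_cast hn
      have hn1 : (1 : ℝ) ≤ √n := Real.one_le_sqrt.2 hn0
      simp only [edgeworthG_eq_setIntegral]
      exact bddAbove_range_abs_sub_edgeworthDensity (K := K ^ 2)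
        (fun _ => abs_normalizedSumDist_le_one _ _ _ _)
        (fun i => hcoef ((hρK i.2).trans hKK) (by linarith))
        (fun i => hcoef ((hκK i.2).trans hKK) (by linarith))
        (fun i => hcoef (by rw [abs_pow]; have := hρK i.2; gcongr) (by linarith))
    · obtain ⟨C, hC, h⟩ := exists_abs_sub_edgeworthG_le hK
      obtain ⟨c, hc0, hc1, hc⟩ := hcr.exists_norm_charFun_le (by positivity : 0 < (8 * K)⁻¹)
      refine IsBigO.of_bound (C * 2) ?_
      filter_upwards [(tendsto_pow_const_mul_const_pow_of_lt_one 3 hc0 hc1).eventually_le_const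
        zero_lt_one, eventually_ge_atTop 2] with n hn1 hn2
      have hn0 : (0 : ℝ) < n := by exact_mod_cast (by omega : 0 < n)
      set N := √(n : ℝ) with hN
      have hN0 : 0 < N := Real.sqrt_pos.2 hn0
      have hNn : (n : ℝ) = N ^ 2 := (Real.sq_sqrt hn0.le).symm
      have hpow : (n : ℝ) ^ (-(3 / 2) : ℝ) = 1 / N ^ 3 := by
        rw [Real.rpow_neg hn0.le, hN, Real.sqrt_eq_rpow, ← Real.rpow_natCast,
          ← Real.rpow_mul hn0.le, one_div]
        norm_num
      rw [hpow, Real.norm_of_nonneg (Real.iSup_nonneg fun _ => abs_nonneg _),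
        Real.norm_of_nonneg (by positivity)]
      refine Real.iSup_le (fun p => ?_) (by positivity)
      rw [normalizedSumDist_eq (hlaw p.2) (by omega)]
      refine (h _ (F p.2) _ _ c n (hint p.2 n) (charFun_normalizedSumLaw (hindep p.2)
        (hlaw p.2) n) (hstd p.2) (hi5 p.2) (h4K p.2) (h5K p.2) (hρK p.2) (hκK p.2) hc0 (hc p.2)
        hn2 p.1).trans ?_
      -- `n ^ 3 * c ^ n ≤ 1` says that `(√n) ^ 3 * c ^ n ≤ 1 / (√n) ^ 3`
      have h6 : N ^ 3 * c ^ n ≤ 1 / N ^ 3 := by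
        rw [le_div_iff₀ (by positivity)]
        rw [hNn] at hn1
        linarith
      rw [mul_assoc]
      exact mul_le_mul_of_nonneg_left (by linarith) hC.le
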